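/- **Theorem 5.6.** Call a sequence $b=\langle b(\alpha):\alpha<\omega_1\rangle$ of (weakly) increasing functions $b(\alpha):\omega\to\omega$ an *unbounded sequence* if $b(\alpha)\le^* b(\beta)$ whenever $\alpha<\beta<\omega_1$, and there is no $h:\omega\to\omega$ with $b(\alpha)\le^* h$ for all $\alpha<\omega_1$. Here $f\le^* g$ means that $f(n)\le g(n)$ for all but finitely many $n$. Two unbounded sequences $b,c$ are *locked by* an infinite set $x\subseteq\omega$ if for every $\alpha<\omega_1$ there is $\beta<\omega_1$ with $c(\alpha)(n)\le b(\beta)(n)$ for all but finitely many $n\in x$, and for every $\alpha<\omega_1$ there is $\beta<\omega_1$ with $b(\alpha)(n)\le c(\beta)(n)$ for all but finitely many $n\in x$. They are *locked* if they are locked by some infinite $x\subseteq\omega$. Let $\mathbb M$ be Miller (rational perfect set) forcing: the set of all nonempty trees $T\subseteq{}^{<\omega}\omega$ of strictly increasing finite sequences such that every $t\in T$ is extended by a splitnode of $T$ (a node with more than one immediate successor in $T$; a node is regarded as extending itself), and every splitnode of $T$ has infinitely many immediate successors in $T$; $\mathbb M$ is ordered by inclusion. For a generic filter $G\subseteq\mathbb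 M$, the Miller real is $f=\bigcup\bigcap G$. Let $b$ and $c$ be unbounded sequences in the ground model. Then $\mathbb M$ forces that $\check b$ and $\check c$ are (still) unbounded sequences, of length the $\omega_1$ of the extension, and that they are locked; in fact it forces that they are locked by the range of the Miller real. -/

import Mathlib

open Filter
open scoped Ordinal

/-! ## Unbounded sequences in the ground model

The ground model is the universe of (small) sets, so ground model reals are functions `ℕ → ℕ`
and ground model `ω₁`-sequences of reals are functions from the well-ordered type of all countable
ordinals to `ℕ → ℕ`. -/

/-- An unbounded sequence: a modulo finite increasing `ω₁`-sequence of increasing functions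
without an upper bound in the eventual domination ordering. (Both occurrences of "increasing" are
in the weak sense.) -/
structure IsUnboundedSeq (b : (ω₁ : Ordinal.{0}).ToType → ℕ → ℕ) : Prop where
  monotone : ∀ α, Monotone (b α)
  eventually_le : ∀ α β, α < β → ∀ᶠ n in atTop, b α n ≤ b β n
  not_bounded : ¬ ∃ h : ℕ → ℕ, ∀ α, ∀ᶠ n in atTop, b α n ≤ h n

/-! ## Miller forcing -/

/-- `s` is a splitnode of `T`: it is a node with more than one immediate successor. -/
def IsSplitNode (T : Descriptive.tree ℕ) (s : List ℕ) : Prop :=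
  s ∈ T ∧ {n : ℕ | s ++ [n] ∈ T}.Nontrivial

/-- Miller trees: nonempty trees of strictly increasing finite sequences, in which
every node is extended by a splitnode, and splitnodes have infinitely many immediate successors. -/
structure IsMillerTree (T : Descriptive.tree ℕ) : Prop where
  nonempty : ∃ s, s ∈ T
  increasing : ∀ s ∈ T, s.Pairwise (· < ·)
  exists_split : ∀ t ∈ T, ∃ s, t <+: s ∧ IsSplitNode T s
  infinite_succ : ∀ s, IsSplitNode T s → {n : ℕ | s ++ [n] ∈ T}.Infinite

/-- Miller (rational perfect set) forcing, ordered by inclusion. -/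
abbrev MillerForcing : Type := {T : Descriptive.tree ℕ // IsMillerTree T}

/-- The tree of all strictly increasing finite sequences. -/
def increasingTree : Descriptive.tree ℕ :=
  ⟨{s | s.Pairwise (· < ·)}, fun _ _ h => (List.pairwise_append.1 h).1⟩

theorem mem_increasingTree {s : List ℕ} : s ∈ increasingTree ↔ s.Pairwise (· < ·) := Iff.rfl

theorem infinite_succ_increasingTree {s : List ℕ} (hs : s ∈ increasingTree) :
    {n : ℕ | s ++ [n] ∈ increasingTree}.Infinite := by
  refine Set.infinite_of_not_bddAbove ?_
  rintro ⟨N, hN⟩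
  have hmem : s.sum + N + 1 ∈ {n : ℕ | s ++ [n] ∈ increasingTree} := by
    change (s ++ [s.sum + N + 1]).Pairwise (· < ·)
    refine List.pairwise_append.2 ⟨hs, List.pairwise_singleton _ _, ?_⟩
    intro a ha c hc
    have h1 := List.le_sum_of_mem ha
    have h2 := List.mem_singleton.1 hc
    omega
  have := hN hmem
  omega

theorem isMillerTree_increasingTree : IsMillerTree increasingTree where
  nonempty := ⟨[], List.Pairwise.nil⟩
  increasing := fun _ hs => hs
  exists_split := fun t ht => ⟨t, List.prefix_rfl, ht, (infinite_succ_increasingTree ht).nontrivial⟩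
  infinite_succ := fun _ hs => infinite_succ_increasingTree hs.1

instance : OrderTop MillerForcing where
  top := ⟨increasingTree, isMillerTree_increasingTree⟩
  le_top T := fun s hs => T.2.increasing s hs

/-! ## Names and the forcing relation

For a poset `P` with largest element (smaller conditions are stronger), `P`-names are sets of
pairs of a `P`-name and a condition. A sentence of the forcing language is given by the set of the
conditions that force it; the clauses below are the usual recursive clauses for the
forcing relation `p ⊩ φ`, and quantifiers range over all `P`-names. -/

/-- `P`-names: `mk ι A c` is the name `{(A i, c i) : i ∈ ι}`. -/
inductive PName (P : Type) : Type 1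
  | mk (ι : Type) (A : ι → PName P) (c : ι → P) : PName P

/-- Sentences of the forcing language over `P`, given by the set of conditions forcing them. -/
abbrev FSent (P : Type) : Type := P → Prop

namespace FSent

variable {P : Type} [Preorder P]

/-- `p ⊩ φ ∧ ψ`. -/
def and (φ ψ : FSent P) : FSent P := fun p => φ p ∧ ψ p

/-- `p ⊩ ¬ φ`: no extension of `p` forces `φ`. -/
def not (φ : FSent P) : FSent P := fun p => ∀ q ≤ p, ¬ φ q

/-- `p ⊩ φ → ψ`: every extension of `p` forcing `φ` forces `ψ`. -/
def imp (φ ψ : FSent P) : FSent P := fun p => ∀ q ≤ p, φ q → ψ q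

/-- `p ⊩ φ ∨ ψ`: densely many extensions of `p` force one of `φ`, `ψ`. -/
def or (φ ψ : FSent P) : FSent P := fun p => ∀ q ≤ p, ∃ r ≤ q, φ r ∨ ψ r

/-- `p ⊩ ∀ x, φ x`. -/
def all {ι : Type*} (φ : ι → FSent P) : FSent P := fun p => ∀ x, φ x p

/-- `p ⊩ ∃ x, φ x`: densely many extensions of `p` force some instance. -/
def ex {ι : Type*} (φ : ι → FSent P) : FSent P := fun p => ∀ q ≤ p, ∃ r ≤ q, ∃ x, φ x r

/-- `P ⊩ φ`: every condition forces `φ`. -/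
def Forced (φ : FSent P) : Prop := ∀ p, φ p

infixr:35 " ⩕ " => FSent.and
infixr:30 " ⩖ " => FSent.or
infixr:25 " ⟾ " => FSent.imp

end FSent

open FSent

namespace PName

section Atomic

variable {P : Type} [Preorder P]

/-- `p ⊩ a = b`: whenever `i` is an index of `a`, every `q ≤ p` below the `i`-th condition of `a`
forces that the `i`-th element of `a` is in `b` (that is, densely many `r ≤ q` are below some
`j`-th condition of `b` and force the `i`-th element of `a` to be equal to the `j`-th
element of `b`), and vice versa. -/
def eq : PName P → PName P → FSent P
  | ⟨_, A, c⟩, ⟨_, B, d⟩ => fun p =>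
    (∀ i, ∀ q ≤ p, q ≤ c i → ∀ q' ≤ q, ∃ r ≤ q', ∃ j, r ≤ d j ∧ eq (A i) (B j) r) ∧
    (∀ j, ∀ q ≤ p, q ≤ d j → ∀ q' ≤ q, ∃ r ≤ q', ∃ i, r ≤ c i ∧ eq (A i) (B j) r)

/-- `p ⊩ a ∈ b`: densely many `r ≤ p` are below some `j`-th condition of `b` and force `a` to be
equal to the `j`-th element of `b`. -/
def mem (a : PName P) : PName P → FSent P
  | ⟨_, B, d⟩ => fun p => ∀ q ≤ p, ∃ r ≤ q, ∃ j, r ≤ d j ∧ eq a (B j) r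

end Atomic

section Names

variable {P : Type} [Preorder P] [OrderTop P]

/-- The canonical name `x̌` of a ground model set `x`. -/
def check : PSet.{0} → PName P
  | ⟨ι, A⟩ => ⟨ι, fun i => check (A i), fun _ => ⊤⟩

/-- The canonical name of the unordered pair `{a, b}`. -/
def upair (a b : PName P) : PName P := ⟨Bool, fun i => cond i a b, fun _ => ⊤⟩

/-- The canonical name of the Kuratowski ordered pair `⟨a, b⟩ = {{a}, {a, b}}`. -/
def pair (a b : PName P) : PName P := upair (upair a a) (upair a b)

/-- The canonical name of the set `ω` of natural numbers. -/
def omega : PName P := check PSet.omega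

/-! ### Formulas of set theory, interpreted in the forcing extension -/

/-- `∀ x ∈ a, φ x`. -/
def ballIn (a : PName P) (φ : PName P → FSent P) : FSent P := all fun x => mem x a ⟾ φ x

/-- `∃ x ∈ a, φ x`. -/
def bexIn (a : PName P) (φ : PName P → FSent P) : FSent P := ex fun x => mem x a ⩕ φ x

/-- `m ≤ n` for natural numbers (finite ordinals), that is `m ∈ n` or `m = n`. -/
def le (m n : PName P) : FSent P := mem m n ⩖ eq m n

/-- `h` is single-valued: `⟨x, y⟩ ∈ h` and `⟨x, y'⟩ ∈ h` imply `y = y'`. -/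
def singleValued (h : PName P) : FSent P :=
  all fun x => all fun y => all fun y' => mem (pair x y) h ⟾ mem (pair x y') h ⟾ eq y y'

/-- `f` is a function from `ω` to `ω`. -/
def isReal (f : PName P) : FSent P :=
  (ballIn f fun z => bexIn omega fun m => bexIn omega fun n => eq z (pair m n)) ⩕
  (ballIn omega fun m => bexIn omega fun n => mem (pair m n) f) ⩕
  singleValued f

/-- `a` is countable: it is contained in the range of some single-valued `h` on `ω`. -/
def isCountable (a : PName P) : FSent P :=
  ex fun h => singleValued h ⩕ ballIn a fun y => bexIn omega fun n => mem (pair n y) h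

/-- `a` is a transitive set. -/
def isTransitive (a : PName P) : FSent P := ballIn a fun x => ballIn x fun y => mem y a

/-- `w` is an ordinal: a transitive set of transitive sets. -/
def isOrdinal (w : PName P) : FSent P := isTransitive w ⩕ ballIn w isTransitive

/-- `w = ω₁`: `w` is an uncountable ordinal all of whose elements are countable. -/
def isOmegaOne (w : PName P) : FSent P :=
  isOrdinal w ⩕ FSent.not (isCountable w) ⩕ ballIn w isCountable

/-- `f` is an increasing function (for `f` from `ω` to `ω`). -/
def isIncreasing (f : PName P) : FSent P :=
  ballIn omega fun m => ballIn omega fun n => mem m n ⟾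
    all fun k => all fun l => mem (pair m k) f ⟾ mem (pair n l) f ⟾ le k l

/-- `g ↾ x` eventually dominates `f ↾ x` (for `x ⊆ ω` and `f, g` from `ω` to `ω`):
`f n ≤ g n` for all but finitely many `n ∈ x`. -/
def evDomOn (x f g : PName P) : FSent P :=
  bexIn omega fun k => ballIn x fun n => mem k n ⟾
    all fun l => all fun m => mem (pair n l) f ⟾ mem (pair n m) g ⟾ le l m

/-- `b` is a function with domain `w` whose values are functions from `ω` to `ω`. -/
def isSeqOfReals (w b : PName P) : FSent P :=
  (ballIn b fun z => bexIn w fun α => ex fun f => isReal f ⩕ eq z (pair α f)) ⩕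
  (ballIn w fun α => ex fun f => mem (pair α f) b) ⩕
  singleValued b

/-- For `w = ω₁`: `b` is an unbounded sequence, that is a modulo finite increasing
`ω₁`-sequence of increasing functions from `ω` to `ω` without an upper bound in the eventual
domination ordering. -/
def isUnbounded (w b : PName P) : FSent P :=
  isSeqOfReals w b ⩕
  (ballIn w fun α => all fun f => mem (pair α f) b ⟾ isIncreasing f) ⩕
  (ballIn w fun α => ballIn w fun β => mem α β ⟾
    all fun f => all fun g => mem (pair α f) b ⟾ mem (pair β g) b ⟾ evDomOn omega f g) ⩕
  FSent.not (ex fun h => isReal h ⩕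
    ballIn w fun α => all fun f => mem (pair α f) b ⟾ evDomOn omega f h)

/-- `x` is an infinite subset of `ω`. -/
def isInfiniteSubset (x : PName P) : FSent P :=
  (ballIn x fun n => mem n omega) ⩕ (ballIn omega fun k => bexIn x fun n => mem k n)

/-- For every `α ∈ w` there is `β ∈ w` with `b(β) ↾ x` eventually dominating `c(α) ↾ x`. -/
def cofinalOn (w x b c : PName P) : FSent P :=
  ballIn w fun α => bexIn w fun β => ex fun f => ex fun g =>
    mem (pair α f) c ⩕ mem (pair β g) b ⩕ evDomOn x f g

/-- `b`, `c` are unbounded sequences (of length `ω₁` in the sense of the extension) which are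
locked by the infinite set `x ⊆ ω`. -/
def lockedBy (x b c : PName P) : FSent P :=
  ex fun w => isOmegaOne w ⩕ isUnbounded w b ⩕ isUnbounded w c ⩕
    isInfiniteSubset x ⩕ cofinalOn w x b c ⩕ cofinalOn w x c b

/-- `b`, `c` are locked unbounded sequences. -/
def locked (b c : PName P) : FSent P := ex fun x => lockedBy x b c

end Names

end PName

/-! ## Names for ground model sequences -/

/-- The ordered pair `⟨a, b⟩ = {{a}, {a, b}}` of ground model sets. -/
def PSet.kpair (a b : PSet.{0}) : PSet.{0} := {{a}, {a, b}}

/-- A function `ℕ → ℕ` as a set of ordered pairs. -/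
def PSet.ofReal (f : ℕ → ℕ) : PSet.{0} :=
  ⟨ℕ, fun n => PSet.kpair (PSet.ofNat n) (PSet.ofNat (f n))⟩

/-- An `ω₁`-sequence of functions `ℕ → ℕ` as a set of ordered pairs. -/
noncomputable def PSet.ofSeq (b : (ω₁ : Ordinal.{0}).ToType → ℕ → ℕ) : PSet.{0} :=
  ⟨(ω₁ : Ordinal.{0}).ToType,
    fun α => PSet.kpair (Ordinal.toPSet (α : Ordinal.{0})) (PSet.ofReal (b α))⟩

/-! ## The Miller real -/

namespace MillerForcing

/-- `p ⊩ Ť ∈ G`, for the generic filter `G` and a condition `T` from the ground model. -/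
def memGeneric (T : MillerForcing) : FSent MillerForcing :=
  fun p => ∀ q ≤ p, ∃ r ≤ q, r ≤ T

/-- `p ⊩ s ∈ ⋂ G`, for a finite sequence `s`: whenever `T ∈ G`, then `s ∈ T`. -/
def memInterGeneric (s : List ℕ) : FSent MillerForcing :=
  all fun T : MillerForcing => memGeneric T ⟾ fun _ => s ∈ T.1

/-- `p ⊩ n ∈ rng (f)`, where `f = ⋃ ⋂ G` is the Miller real: `n` is an entry of some `s ∈ ⋂ G`. -/
def memRange (n : ℕ) : FSent MillerForcing :=
  ex fun s : List ℕ => memInterGeneric s ⩕ fun _ => n ∈ s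

/-- The name `{(ň, p) : p ⊩ n ∈ rng (f)}` of the range of the Miller real `f`. -/
def rangeName : PName MillerForcing :=
  ⟨{y : ℕ × MillerForcing // memRange y.1 y.2},
    fun y => PName.check (PSet.ofNat y.1.1), fun y => y.1.2⟩

end MillerForcing

/-! Locking. Fix a condition `T` and `α`. At each splitnode `s` the generic branch picks a successor
`n` and then runs without further choice to the next splitnode. The entries `k` collected on this
stretch satisfy `n ≤ k ≤ N`, where `N` is the sum of the entries of that next splitnode. Members of
`b` are monotone, so `b` is unbounded on every infinite subset of `ω`; hence some `b β` satisfies `c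
α N ≤ b β n` for infinitely many successors `n` of `s`. There are only countably many nodes, so one
`β` serves all `s`, and `T` can be thinned to those successors. Then `c α k ≤ c α N ≤ b β n ≤ b β k`
for all entries `k` beyond a finite initial stretch. This is `IsUnboundedSeq.exists_dominating`; the
argument is symmetric in `b` and `c`.

Preservation. By fusion (`exists_fusion`), a name can be decided at every immediate successor of a
splitnode. If the first `t.length` values of a map from `ω` to `ω₁` are decided at each such `t`,
only countably many values are possible, so `ω₁` stays uncountable. If `h n` is decided at each `s
++ [n]`, thinning makes some `b α` exceed the decided values; every further extension still has such
`n` arbitrarily large, so `h` is no bound.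

The rest translates between ground model facts and forced formulas. The notion `Ext` allows a
quantifier over a canonical name to be checked on ground model elements only. -/

namespace PName

/-! ### Forced equality and membership -/

section Preorder

variable {P : Type} [Preorder P]

theorem eq_mk {ι κ : Type} {A : ι → PName P} {c : ι → P} {B : κ → PName P} {d : κ → P} {p : P} :
    eq ⟨ι, A, c⟩ ⟨κ, B, d⟩ p ↔
    (∀ i, ∀ q ≤ p, q ≤ c i → ∀ q' ≤ q, ∃ r ≤ q', ∃ j, r ≤ d j ∧ eq (A i) (B j) r) ∧
    (∀ j, ∀ q ≤ p, q ≤ d j → ∀ q' ≤ q, ∃ r ≤ q', ∃ i, r ≤ c i ∧ eq (A i) (B j) r) := by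
  rw [eq]

theorem mem_mk {κ : Type} {a : PName P} {B : κ → PName P} {d : κ → P} {p : P} :
    mem a ⟨κ, B, d⟩ p ↔ ∀ q ≤ p, ∃ r ≤ q, ∃ j, r ≤ d j ∧ eq a (B j) r := by
  rw [mem]

theorem eq_mono : ∀ {a b : PName P} {p q : P}, q ≤ p → eq a b p → eq a b q
  | ⟨_, _, _⟩, ⟨_, _, _⟩, _, _, hqp, h => by
    rw [eq_mk] at h ⊢
    exact ⟨fun i r hr => h.1 i r (hr.trans hqp), fun j r hr => h.2 j r (hr.trans hqp)⟩

/-- Each clause of forced equality is itself a density statement, so a dense set of witnesses can be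
absorbed into it. -/
theorem eq_local : ∀ {a b : PName P} {p : P}, (∀ q ≤ p, ∃ r ≤ q, eq a b r) → eq a b p
  | ⟨_, _, _⟩, ⟨_, _, _⟩, p, h => by
    rw [eq_mk]
    constructor
    · intro i q hq hqi q' hq'
      obtain ⟨r, hr, h'⟩ := h q' (hq'.trans hq)
      obtain ⟨s, hs, H⟩ := (eq_mk.1 h').1 i r le_rfl (hr.trans (hq'.trans hqi)) r le_rfl
      exact ⟨s, hs.trans hr, H⟩
    · intro i q hq hqi q' hq'
      obtain ⟨r, hr, h'⟩ := h q' (hq'.trans hq)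
      obtain ⟨s, hs, H⟩ := (eq_mk.1 h').2 i r le_rfl (hr.trans (hq'.trans hqi)) r le_rfl
      exact ⟨s, hs.trans hr, H⟩

theorem eq_refl : ∀ (a : PName P) (p : P), eq a a p
  | ⟨_, A, _⟩, _ => by
    rw [eq_mk]
    exact ⟨fun i q _ hi q' hq' => ⟨q', le_rfl, i, hq'.trans hi, eq_refl (A i) _⟩,
      fun i q _ hi q' hq' => ⟨q', le_rfl, i, hq'.trans hi, eq_refl (A i) _⟩⟩

theorem eq_symm : ∀ {a b : PName P} {p : P}, eq a b p → eq b a p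
  | ⟨_, _, _⟩, ⟨_, _, _⟩, _, h => by
    rw [eq_mk] at h ⊢
    constructor
    · intro j q hq hj q' hq'
      obtain ⟨r, hr, i, hi, H⟩ := h.2 j q hq hj q' hq'
      exact ⟨r, hr, i, hi, eq_symm H⟩
    · intro j q hq hj q' hq'
      obtain ⟨r, hr, i, hi, H⟩ := h.1 j q hq hj q' hq'
      exact ⟨r, hr, i, hi, eq_symm H⟩

theorem eq_trans : ∀ {a b c : PName P} {p : P}, eq a b p → eq b c p → eq a c p
  | ⟨_, _, _⟩, ⟨_, _, _⟩, ⟨_, _, _⟩, _, h, h' => by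
    rw [eq_mk] at h h' ⊢
    constructor
    · intro i q hq hi q' hq'
      obtain ⟨r, hr, j, hj, H⟩ := h.1 i q hq hi q' hq'
      obtain ⟨s, hs, k, hk, H'⟩ := h'.1 j r (hr.trans (hq'.trans hq)) hj r le_rfl
      exact ⟨s, hs.trans hr, k, hk, eq_trans (eq_mono hs H) H'⟩
    · intro k q hq hk q' hq'
      obtain ⟨r, hr, j, hj, H⟩ := h'.2 k q hq hk q' hq'
      obtain ⟨s, hs, i, hi, H'⟩ := h.2 j r (hr.trans (hq'.trans hq)) hj r le_rfl
      exact ⟨s, hs.trans hr, i, hi, eq_trans H' (eq_mono hs H)⟩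

theorem mem_mono : ∀ {a b : PName P} {p q : P}, q ≤ p → mem a b p → mem a b q
  | _, ⟨_, _, _⟩, _, _, hqp, h => by
    rw [mem_mk] at h ⊢
    exact fun r hr => h r (hr.trans hqp)

theorem mem_local : ∀ {a b : PName P} {p : P}, (∀ q ≤ p, ∃ r ≤ q, mem a b r) → mem a b p
  | _, ⟨_, _, _⟩, _, h => by
    rw [mem_mk]
    intro q hq
    obtain ⟨r, hr, h'⟩ := h q hq
    obtain ⟨s, hs, H⟩ := mem_mk.1 h' r le_rfl
    exact ⟨s, hs.trans hr, H⟩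

theorem mem_congr_left : ∀ {a a' b : PName P} {p : P}, eq a a' p → mem a b p → mem a' b p
  | _, _, ⟨_, _, _⟩, _, e, h => by
    rw [mem_mk] at h ⊢
    intro q hq
    obtain ⟨r, hr, j, hj, H⟩ := h q hq
    exact ⟨r, hr, j, hj, eq_trans (eq_symm (eq_mono (hr.trans hq) e)) H⟩

theorem mem_congr_right : ∀ {a b b' : PName P} {p : P}, eq b b' p → mem a b p → mem a b' p
  | _, ⟨_, _, _⟩, ⟨_, _, _⟩, _, e, h => by
    rw [mem_mk] at h ⊢
    rw [eq_mk] at e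
    intro q hq
    obtain ⟨r, hr, j, hj, H⟩ := h q hq
    obtain ⟨s, hs, k, hk, H'⟩ := e.1 j r (hr.trans hq) hj r le_rfl
    exact ⟨s, hs.trans hr, k, hk, eq_trans (eq_mono hs H) H'⟩

/-- A property of names that behaves like a formula of the forcing language: it is inherited by
stronger conditions, it is forced if it is densely forced, and it respects forced equality. -/
structure Ext (φ : PName P → FSent P) : Prop where
  mono : ∀ {x p q}, q ≤ p → φ x p → φ x q
  dense : ∀ {x p}, (∀ q ≤ p, ∃ r ≤ q, φ x r) → φ x p
  congr : ∀ {x y p}, eq x y p → φ x p → φ y p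

/-- An operation on names that respects forced equality. -/
structure Resp (A : PName P → PName P) : Prop where
  congr : ∀ {x y p}, eq x y p → eq (A x) (A y) p

theorem Resp.id : Resp fun x : PName P => x := ⟨fun h => h⟩

theorem Resp.const (a : PName P) : Resp fun _ : PName P => a := ⟨fun _ => eq_refl _ _⟩

namespace Ext

theorem mem {A B : PName P → PName P} (hA : Resp A) (hB : Resp B) :
    Ext fun x => PName.mem (A x) (B x) where
  mono := mem_mono
  dense := mem_local
  congr e h := mem_congr_right (hB.congr e) (mem_congr_left (hA.congr e) h)

theorem eq {A B : PName P → PName P} (hA : Resp A) (hB : Resp B) :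
    Ext fun x => PName.eq (A x) (B x) where
  mono := eq_mono
  dense := eq_local
  congr e h := eq_trans (eq_symm (hA.congr e)) (eq_trans h (hB.congr e))

variable {φ ψ : PName P → FSent P}

theorem and (hφ : Ext φ) (hψ : Ext ψ) : Ext fun x => φ x ⩕ ψ x where
  mono hq h := ⟨hφ.mono hq h.1, hψ.mono hq h.2⟩
  dense h := ⟨hφ.dense fun q hq => (h q hq).imp fun _ h => ⟨h.1, h.2.1⟩,
    hψ.dense fun q hq => (h q hq).imp fun _ h => ⟨h.1, h.2.2⟩⟩
  congr e h := ⟨hφ.congr e h.1, hψ.congr e h.2⟩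

theorem imp (hφ : Ext φ) (hψ : Ext ψ) : Ext fun x => φ x ⟾ ψ x where
  mono hq h r hr := h r (hr.trans hq)
  dense h q hq hφq := hψ.dense fun q' hq' => by
    obtain ⟨r, hr, H⟩ := h q' (hq'.trans hq)
    exact ⟨r, hr, H r le_rfl (hφ.mono (hr.trans hq') hφq)⟩
  congr e h q hq hφq := hψ.congr (eq_mono hq e) (h q hq (hφ.congr (eq_symm (eq_mono hq e)) hφq))

theorem or (hφ : Ext φ) (hψ : Ext ψ) : Ext fun x => φ x ⩖ ψ x where
  mono hq h r hr := h r (hr.trans hq)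
  dense h q hq := by
    obtain ⟨r, hr, H⟩ := h q hq
    obtain ⟨s, hs, H⟩ := H r le_rfl
    exact ⟨s, hs.trans hr, H⟩
  congr e h q hq := by
    obtain ⟨r, hr, H⟩ := h q hq
    exact ⟨r, hr, H.imp (hφ.congr (eq_mono (hr.trans hq) e)) (hψ.congr (eq_mono (hr.trans hq) e))⟩

theorem all {ι : Type*} {φ : ι → PName P → FSent P} (h : ∀ i, Ext (φ i)) :
    Ext fun x => FSent.all fun i => φ i x where
  mono hq H i := (h i).mono hq (H i)
  dense H i := (h i).dense fun q hq => (H q hq).imp fun _ H => ⟨H.1, H.2 i⟩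
  congr e H i := (h i).congr e (H i)

theorem ex {ι : Type*} {φ : ι → PName P → FSent P} (h : ∀ i, Ext (φ i)) :
    Ext fun x => FSent.ex fun i => φ i x where
  mono hq h r hr := h r (hr.trans hq)
  dense h q hq := by
    obtain ⟨r, hr, H⟩ := h q hq
    obtain ⟨s, hs, H⟩ := H r le_rfl
    exact ⟨s, hs.trans hr, H⟩
  congr e H q hq := by
    obtain ⟨r, hr, i, H⟩ := H q hq
    exact ⟨r, hr, i, (h i).congr (eq_mono (hr.trans hq) e) H⟩

theorem le {A B : PName P → PName P} (hA : Resp A) (hB : Resp B) :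
    Ext fun x => PName.le (A x) (B x) :=
  or (mem hA hB) (eq hA hB)

theorem ballIn {A : PName P → PName P} {φ : PName P → PName P → FSent P} (hA : Resp A)
    (hφ : ∀ y, Ext fun x => φ x y) : Ext fun x => PName.ballIn (A x) (φ x) :=
  all fun y => imp (mem (Resp.const y) hA) (hφ y)

theorem bexIn {A : PName P → PName P} {φ : PName P → PName P → FSent P} (hA : Resp A)
    (hφ : ∀ y, Ext fun x => φ x y) : Ext fun x => PName.bexIn (A x) (φ x) :=
  ex fun y => and (mem (Resp.const y) hA) (hφ y)

theorem isTransitive {A : PName P → PName P} (hA : Resp A) : Ext fun x => PName.isTransitive (A x) :=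
  ballIn hA fun _ => ballIn (.const _) fun _ => mem (.const _) hA

end Ext

theorem exists_of_ex {ι : Type*} {φ : ι → FSent P} {p : P} (h : ex φ p) : ∃ r ≤ p, ∃ i, φ i r :=
  h p le_rfl

theorem ex_intro {ι : Type*} {φ : ι → FSent P} {p : P} (i : ι) (h : ∀ q ≤ p, φ i q) : ex φ p :=
  fun q hq => ⟨q, le_rfl, i, h q hq⟩

end Preorder

/-! ### Ordered pairs and canonical names -/

section Top

variable {P : Type} [Preorder P] [OrderTop P]

theorem eq_of_forall_exists {ι κ : Type} {A : ι → PName P} {B : κ → PName P} {p : P}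
    (h : ∀ i, ∃ j, eq (A i) (B j) p) (h' : ∀ j, ∃ i, eq (A i) (B j) p) :
    eq ⟨ι, A, fun _ => ⊤⟩ ⟨κ, B, fun _ => ⊤⟩ p := by
  rw [eq_mk]
  constructor
  · intro i q hq _ q' hq'
    obtain ⟨j, hj⟩ := h i
    exact ⟨q', le_rfl, j, le_top, eq_mono (hq'.trans hq) hj⟩
  · intro i q hq _ q' hq'
    obtain ⟨j, hj⟩ := h' i
    exact ⟨q', le_rfl, j, le_top, eq_mono (hq'.trans hq) hj⟩

theorem eq_upair {a b a' b' : PName P} {p : P} (h : eq a a' p) (h' : eq b b' p) :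
    eq (upair a b) (upair a' b') p :=
  eq_of_forall_exists (fun i => ⟨i, by cases i <;> assumption⟩)
    fun i => ⟨i, by cases i <;> assumption⟩

theorem eq_pair {a b a' b' : PName P} {p : P} (h : eq a a' p) (h' : eq b b' p) :
    eq (pair a b) (pair a' b') p :=
  eq_upair (eq_upair h h) (eq_upair h h')

theorem Resp.pair {A B : PName P → PName P} (hA : Resp A) (hB : Resp B) :
    Resp fun x => PName.pair (A x) (B x) :=
  ⟨fun h => eq_pair (hA.congr h) (hB.congr h)⟩

theorem mem_upair {x a b : PName P} {p : P} : mem x (upair a b) p ↔ (eq x a ⩖ eq x b) p := by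
  rw [upair, mem_mk]
  refine forall₂_congr fun q _ => exists_congr fun r => and_congr_right fun _ => ?_
  simp only [le_top, true_and, Bool.exists_bool, cond_true, cond_false]
  exact or_comm

theorem mem_upair_left {a b : PName P} {p : P} : mem a (upair a b) p :=
  mem_upair.2 fun q _ => ⟨q, le_rfl, Or.inl (eq_refl _ _)⟩

theorem mem_upair_right {a b : PName P} {p : P} : mem b (upair a b) p :=
  mem_upair.2 fun q _ => ⟨q, le_rfl, Or.inr (eq_refl _ _)⟩

theorem exists_of_mem_upair {x a b : PName P} {p : P} (h : mem x (upair a b) p) :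
    ∃ r ≤ p, eq x a r ∨ eq x b r := mem_upair.1 h p le_rfl

theorem eq_of_mem_upair_self {x a : PName P} {p : P} (h : mem x (upair a a) p) : eq x a p :=
  eq_local fun q hq => by simpa using exists_of_mem_upair (mem_mono hq h)

/-- The set `{a}` is an element of `{{c}, {c, d}}`, and both candidates contain `c`; so `c ∈ {a}`.
-/
theorem eq_fst_of_eq_pair {a b c d : PName P} {p : P} (h : eq (pair a b) (pair c d) p) :
    eq a c p := by
  refine eq_local fun q hq => ?_
  obtain ⟨r, hr, H⟩ := exists_of_mem_upair
    (mem_mono hq (mem_congr_right h (mem_upair_left : mem (upair a a) (pair a b) p)))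
  refine ⟨r, hr, eq_symm (eq_of_mem_upair_self (a := a) ?_)⟩
  rcases H with H | H <;> exact mem_congr_right (eq_symm H) mem_upair_left

/-- Densely, `b` is `c` or `d`, and `d` is `a` or `b`. Only the case `b = c`, `d = a` needs an
argument, and there `a = c` helps. -/
theorem eq_snd_of_eq_pair {a b c d : PName P} {p : P} (h : eq (pair a b) (pair c d) p) :
    eq b d p := by
  have hac := eq_fst_of_eq_pair h
  refine eq_local fun q hq => ?_
  obtain ⟨r, hr, H⟩ := exists_of_mem_upair
    (mem_mono hq (mem_congr_right h (mem_upair_right : mem (upair a b) (pair a b) p)))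
  obtain ⟨s, hs, H'⟩ := exists_of_mem_upair
    (mem_mono (hr.trans hq) (mem_congr_right (eq_symm h)
      (mem_upair_right : mem (upair c d) (pair c d) p)))
  have hac := eq_mono (hs.trans (hr.trans hq)) hac
  have key : ∀ {t}, t ≤ s → eq b c t → eq d a t ∨ eq d b t → eq b d t := by
    intro t ht hbc hd
    rcases hd with hd | hd
    · exact eq_trans hbc (eq_symm (eq_trans hd (eq_mono ht hac)))
    · exact eq_symm hd
  have hd : ∃ t ≤ s, eq d a t ∨ eq d b t := by
    rcases H' with H' | H'
    · exact ⟨s, le_rfl, Or.inl (eq_of_mem_upair_self (mem_congr_right H' mem_upair_right))⟩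
    · exact exists_of_mem_upair (mem_congr_right H' mem_upair_right)
  obtain ⟨t, ht, hd⟩ := hd
  have hb : ∃ u ≤ t, eq b c u ∨ eq b d u := by
    rcases H with H | H
    · exact ⟨t, le_rfl, Or.inl (eq_mono (ht.trans hs)
        (eq_of_mem_upair_self (mem_congr_right H mem_upair_right)))⟩
    · exact exists_of_mem_upair (mem_mono (ht.trans hs) (mem_congr_right H mem_upair_right))
  obtain ⟨u, hu, hb⟩ := hb
  refine ⟨u, hu.trans (ht.trans (hs.trans hr)), ?_⟩
  rcases hb with hb | hb
  · exact key (hu.trans ht) hb (hd.imp (eq_mono hu) (eq_mono hu))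
  · exact hb

/-! ### Canonical names -/

theorem check_mk {ι : Type} {A : ι → PSet} :
    check (P := P) ⟨ι, A⟩ = ⟨ι, fun i => check (A i), fun _ => ⊤⟩ := by
  rw [check]

theorem eq_check_of_equiv : ∀ {x y : PSet} (p : P), PSet.Equiv x y → eq (check x) (check y) p
  | ⟨_, _⟩, ⟨_, _⟩, p, h => by
    rw [check_mk, check_mk]
    refine eq_of_forall_exists (fun i => ?_) fun j => ?_
    · exact (h.1 i).imp fun j hj => eq_check_of_equiv p hj
    · exact (h.2 j).imp fun j hj => eq_check_of_equiv p hj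

theorem equiv_of_eq_check : ∀ {x y : PSet} {p : P}, eq (check x) (check y) p → PSet.Equiv x y
  | ⟨_, _⟩, ⟨_, _⟩, p, h => by
    rw [check_mk, check_mk, eq_mk] at h
    constructor
    · intro i
      obtain ⟨r, -, j, -, H⟩ := h.1 i p le_rfl le_top p le_rfl
      exact ⟨j, equiv_of_eq_check H⟩
    · intro i
      obtain ⟨r, -, j, -, H⟩ := h.2 i p le_rfl le_top p le_rfl
      exact ⟨j, equiv_of_eq_check H⟩

theorem eq_check {x y : PSet} {p : P} : eq (check x) (check y) p ↔ PSet.Equiv x y :=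
  ⟨equiv_of_eq_check, eq_check_of_equiv p⟩

theorem mem_check {a : PName P} {x : PSet} {p : P} :
    mem a (check x) p ↔ ∀ q ≤ p, ∃ r ≤ q, ∃ i, eq a (check (x.Func i)) r := by
  obtain ⟨ι, A⟩ := x
  rw [check_mk, mem_mk]
  simp

theorem check_mem_check {x y : PSet} {p : P} : mem (check x) (check y) p ↔ x ∈ y := by
  rw [mem_check, PSet.mem_def]
  simp only [eq_check]
  constructor
  · intro h
    obtain ⟨r, -, h⟩ := h p le_rfl
    exact h
  · exact fun h q _ => ⟨q, le_rfl, h⟩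

/-- A name forced into `x̌` is only densely equal to canonical names of elements of `x`; the density
and congruence of `φ` bridge this gap. -/
theorem ballIn_check {φ : PName P → FSent P} (hφ : Ext φ) {x : PSet} {p : P} :
    ballIn (check x) φ p ↔ ∀ i, φ (check (x.Func i)) p := by
  constructor
  · exact fun h i => h _ p le_rfl (check_mem_check.2 (x.func_mem i))
  · intro h y q hq hy
    refine hφ.dense fun q' hq' => ?_
    obtain ⟨r, hr, i, hi⟩ := mem_check.1 hy q' hq'
    exact ⟨r, hr, hφ.congr (eq_symm hi) (hφ.mono (hr.trans (hq'.trans hq)) (h i))⟩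

theorem bexIn_check_intro {φ : PName P → FSent P} (hφ : Ext φ) {x : PSet} {p : P} (i : x.Type)
    (h : φ (check (x.Func i)) p) : bexIn (check x) φ p :=
  fun q hq => ⟨q, le_rfl, _, check_mem_check.2 (x.func_mem i), hφ.mono hq h⟩

theorem exists_of_bexIn_check {φ : PName P → FSent P} (hφ : Ext φ) {x : PSet} {p : P}
    (h : bexIn (check x) φ p) : ∃ r ≤ p, ∃ i, φ (check (x.Func i)) r := by
  obtain ⟨r, hr, y, hy, H⟩ := h p le_rfl
  obtain ⟨s, hs, i, hi⟩ := mem_check.1 hy r le_rfl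
  exact ⟨s, hs.trans hr, i, hφ.congr hi (hφ.mono hs H)⟩

theorem ballIn_omega {φ : PName P → FSent P} (hφ : Ext φ) {p : P} :
    ballIn omega φ p ↔ ∀ n, φ (check (PSet.ofNat n)) p := by
  rw [omega, ballIn_check hφ]
  exact ⟨fun h n => h ⟨n⟩, fun h n => h n.down⟩

theorem bexIn_omega_intro {φ : PName P → FSent P} (hφ : Ext φ) {p : P} (n : ℕ)
    (h : φ (check (PSet.ofNat n)) p) : bexIn omega φ p :=
  bexIn_check_intro hφ (x := PSet.omega) ⟨n⟩ h

theorem exists_of_bexIn_omega {φ : PName P → FSent P} (hφ : Ext φ) {p : P}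
    (h : bexIn omega φ p) : ∃ r ≤ p, ∃ n, φ (check (PSet.ofNat n)) r := by
  obtain ⟨r, hr, n, H⟩ := exists_of_bexIn_check hφ h
  exact ⟨r, hr, n.down, H⟩

theorem eq_check_upair (x y : PSet) (p : P) :
    eq (check {x, y}) (upair (check x) (check y)) p := by
  have h : upair (P := P) (check x) (check y) = check ⟨Bool, fun i => cond i x y⟩ := by
    rw [check_mk, upair]
    congr 1
    funext i
    cases i <;> rfl
  rw [h, eq_check]
  refine PSet.Mem.ext fun w => ?_
  rw [PSet.mem_pair, PSet.mem_def]
  simp [or_comm, PSet.Func]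

theorem eq_check_singleton (x : PSet) (p : P) :
    eq (check {x}) (upair (check x) (check x)) p := by
  refine eq_trans (eq_check.2 ?_) (eq_check_upair x x p)
  exact PSet.Mem.ext fun w => by rw [PSet.mem_pair, PSet.mem_singleton, or_self]

theorem eq_check_kpair (x y : PSet) (p : P) :
    eq (check (PSet.kpair x y)) (pair (check x) (check y)) p :=
  eq_trans (eq_check_upair _ _ p) (eq_upair (eq_check_singleton _ _) (eq_check_upair _ _ _))

/-- A pair belongs to the canonical name of a ground model relation if and only if it is densely
equal to some pair in that relation. -/
theorem pair_mem_check {ι : Type} {X Y : ι → PSet} {x y : PName P} {p : P} :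
    mem (pair x y) (check ⟨ι, fun i => PSet.kpair (X i) (Y i)⟩) p ↔
      ∀ q ≤ p, ∃ r ≤ q, ∃ i, eq x (check (X i)) r ∧ eq y (check (Y i)) r := by
  rw [mem_check]
  refine forall₂_congr fun q _ => exists_congr fun r => and_congr_right fun _ =>
    exists_congr fun i => ⟨fun h => ?_, fun h => ?_⟩
  · have := eq_trans h (eq_check_kpair _ _ _)
    exact ⟨eq_fst_of_eq_pair this, eq_snd_of_eq_pair this⟩
  · exact eq_trans (eq_pair h.1 h.2) (eq_symm (eq_check_kpair _ _ _))

theorem pair_mem_check_intro {ι : Type} {X Y : ι → PSet} (i : ι) (p : P) :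
    mem (pair (check (X i)) (check (Y i))) (check ⟨ι, fun i => PSet.kpair (X i) (Y i)⟩) p :=
  pair_mem_check.2 fun q _ => ⟨q, le_rfl, i, eq_refl _ _, eq_refl _ _⟩

theorem eq_of_pair_mem_check {ι : Type} {X Y : ι → PSet}
    (hX : ∀ i j, PSet.Equiv (X i) (X j) → i = j) {i : ι} {y : PName P} {p : P}
    (h : mem (pair (check (X i)) y) (check ⟨ι, fun i => PSet.kpair (X i) (Y i)⟩) p) :
    eq y (check (Y i)) p := by
  refine eq_local fun q hq => ?_
  obtain ⟨r, hr, j, hj, H⟩ := pair_mem_check.1 h q hq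
  obtain rfl := hX _ _ (eq_check.1 hj)
  exact ⟨r, hr, H⟩

theorem singleValued_check {ι : Type} {X Y : ι → PSet}
    (hX : ∀ i j, PSet.Equiv (X i) (X j) → i = j) (p : P) :
    singleValued (check ⟨ι, fun i => PSet.kpair (X i) (Y i)⟩) p := by
  intro x y y' q _ hy q' hq' hy'
  refine eq_local fun s hs => ?_
  obtain ⟨r, hr, i, hi, H⟩ := pair_mem_check.1 hy s (hs.trans hq')
  obtain ⟨t, ht, j, hj, H'⟩ := pair_mem_check.1 hy' r (hr.trans hs)
  obtain rfl := hX _ _ (eq_check.1 (eq_trans (eq_symm (eq_mono ht hi)) hj))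
  exact ⟨t, ht.trans hr, eq_trans (eq_mono ht H) (eq_symm H')⟩

end Top

end PName

/-! ## Combinatorics of Miller trees -/

/-- Otherwise both `s ++ [m]` and `s ++ [n]` would be initial segments of `t` of the same length.
This places the splitnodes of a restricted tree above the restricting node. -/
theorem List.prefix_of_concat_prefix_of_ne {α : Type*} {s t : List α} {m n : α} (hmn : m ≠ n)
    (hm : s ++ [m] <+: t ∨ t <+: s ++ [m]) (hn : s ++ [n] <+: t ∨ t <+: s ++ [n]) : t <+: s := by
  by_contra h
  have key : ∀ k, s ++ [k] <+: t ∨ t <+: s ++ [k] → s ++ [k] <+: t := by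
    rintro k (hk | hk)
    · exact hk
    · rcases List.prefix_concat_iff.1 hk with rfl | hk
      · exact List.prefix_rfl
      · exact absurd hk h
  have := (List.prefix_of_prefix_length_le (key m hm) (key n hn) (by simp)).eq_of_length (by simp)
  simp_all

theorem List.prefix_comparable {α : Type*} {s u t : List α} (hs : s <+: u)
    (h : u <+: t ∨ t <+: u) : s <+: t ∨ t <+: s :=
  h.elim (fun h => Or.inl (hs.trans h)) fun h => List.prefix_or_prefix_of_prefix hs h

namespace MillerForcing

open Descriptive

theorem mem_of_prefix {T : tree ℕ} {s t : List ℕ} (h : s <+: t) (ht : t ∈ T) : s ∈ T :=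
  Tree.mem_of_prefix h ht

theorem _root_.IsSplitNode.mono {S T : tree ℕ} {s : List ℕ} (h : ∀ t, t ∈ S → t ∈ T)
    (hs : IsSplitNode S s) : IsSplitNode T s :=
  ⟨h _ hs.1, hs.2.mono fun _ => h _⟩

theorem nil_mem (T : MillerForcing) : [] ∈ T.1 := by
  obtain ⟨s, hs⟩ := T.2.nonempty
  exact mem_of_prefix List.nil_prefix hs

theorem exists_splitNode_length (T : MillerForcing) {t : List ℕ} (ht : t ∈ T.1) (k : ℕ) :
    ∃ s, t <+: s ∧ IsSplitNode T.1 s ∧ k ≤ s.length := by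
  induction k with
  | zero =>
    obtain ⟨s, h, h'⟩ := T.2.exists_split t ht
    exact ⟨s, h, h', Nat.zero_le _⟩
  | succ k ih =>
    obtain ⟨s, h, h', hk⟩ := ih
    obtain ⟨n, hn⟩ := h'.2.nonempty
    obtain ⟨u, hu, hu'⟩ := T.2.exists_split _ hn
    refine ⟨u, h.trans ((List.prefix_append s [n]).trans hu), hu', ?_⟩
    have := hu.length_le
    simp at this
    omega

/-- Every node has a shortest splitnode above it. -/
theorem exists_minimal_splitNode (T : MillerForcing) {t : List ℕ} (ht : t ∈ T.1) :
    ∃ s, t <+: s ∧ IsSplitNode T.1 s ∧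
      ∀ u, t <+: u → u <+: s → u ≠ s → ¬ IsSplitNode T.1 u := by
  classical
  have h : ∃ k, ∃ s, t <+: s ∧ IsSplitNode T.1 s ∧ s.length = k := by
    obtain ⟨s, h, h'⟩ := T.2.exists_split t ht
    exact ⟨_, s, h, h', rfl⟩
  obtain ⟨s, h1, h2, h3⟩ := Nat.find_spec h
  refine ⟨s, h1, h2, fun u hu hus hne hsplit => hne (hus.eq_of_length ?_)⟩
  have := Nat.find_min' h ⟨u, hu, hsplit, rfl⟩
  have := hus.length_le
  omega

/-- If no splitnode lies between `t` and `x`, then every node above `t` that is not a proper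
initial segment of `x` extends `x`. -/
theorem prefix_of_forall_not_splitNode {T : tree ℕ} {t x y : List ℕ} (hx : x ∈ T) (hy : y ∈ T)
    (htx : t <+: x) (hty : t <+: y)
    (h : ∀ v, t <+: v → v <+: x → v ≠ x → ¬ IsSplitNode T v) (hyx : y <+: x → y = x) :
    x <+: y := by
  obtain ⟨z, rfl⟩ := htx
  induction z using List.reverseRecOn with
  | nil => simpa using hty
  | append_singleton z a ih =>
    have hp : t ++ z <+: t ++ (z ++ [a]) := ⟨[a], by simp⟩
    have hxy : t ++ z <+: y := by
      refine ih (mem_of_prefix hp hx) (fun v hv hvz _ => ?_) fun hyz => ?_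
      · refine h v hv (hvz.trans hp) fun he => ?_
        have := hvz.length_le
        simp [he] at this
      · have h1 := hyx (hyz.trans hp)
        have h2 := hyz.length_le
        simp [h1] at h2
    obtain ⟨w, rfl⟩ := hxy
    match w with
    | [] =>
      have := hyx (by simp)
      simp at this
    | c :: w =>
      have hc : t ++ z ++ [c] ∈ T := mem_of_prefix ⟨w, by simp⟩ hy
      have hn := h (t ++ z) (List.prefix_append _ _) hp (by simp)
      have hac : a = c := by
        by_contra hac
        exact hn ⟨mem_of_prefix hp hx, a, by simpa using hx, c, hc, hac⟩
      subst hac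
      exact ⟨w, by simp⟩

/-- The subtree of all nodes of `T` that are comparable with `t`. -/
def restrict (T : MillerForcing) (t : List ℕ) (ht : t ∈ T.1) : MillerForcing where
  val := ⟨{s | s ∈ T.1 ∧ (s <+: t ∨ t <+: s)}, fun s n h =>
    ⟨mem_of_prefix (List.prefix_append _ _) h.1,
      List.prefix_comparable (List.prefix_append s [n]) h.2⟩⟩
  property := by
    -- At nodes above `t` the restriction removes no successors.
    have split : ∀ s, t <+: s → IsSplitNode T.1 s →
        {n | s ++ [n] ∈ T.1 ∧ (s ++ [n] <+: t ∨ t <+: s ++ [n])} = {n | s ++ [n] ∈ T.1} :=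
      fun s hts _ => Set.ext fun n =>
        and_iff_left (Or.inr (hts.trans (List.prefix_append _ _)))
    refine ⟨⟨t, ht, Or.inl List.prefix_rfl⟩, fun s hs => T.2.increasing s hs.1, ?_, ?_⟩
    · intro s hs
      have : ∃ u, s <+: u ∧ t <+: u ∧ u ∈ T.1 :=
        hs.2.elim (fun h => ⟨t, h, List.prefix_rfl, ht⟩) fun h => ⟨s, List.prefix_rfl, h, hs.1⟩
      obtain ⟨u, hsu, htu, hu⟩ := this
      obtain ⟨v, huv, hv⟩ := T.2.exists_split u hu
      refine ⟨v, hsu.trans huv, ⟨hv.1, Or.inr (htu.trans huv)⟩, ?_⟩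
      have := hv.2
      rw [← split v (htu.trans huv) hv] at this
      exact this
    · rintro s ⟨hs, m, hm, n, hn, hmn⟩
      have hts := List.prefix_of_concat_prefix_of_ne hmn hm.2 hn.2
      have hs : IsSplitNode T.1 s := ⟨hs.1, m, hm.1, n, hn.1, hmn⟩
      have := T.2.infinite_succ s hs
      rw [← split s hts hs] at this
      exact this

variable {T : MillerForcing} {t : List ℕ} {ht : t ∈ T.1}

theorem restrict_le : restrict T t ht ≤ T := fun _ h => h.1

theorem restrict_le_restrict {S : MillerForcing} (h : S ≤ T) (hS : t ∈ S.1) :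
    restrict S t hS ≤ restrict T t (h hS) := fun _ hs => ⟨h hs.1, hs.2⟩

/-- A Miller tree has nodes of length at least `t.length`, and in the restricted tree such nodes
extend `t`. -/
theorem mem_of_le_restrict {S : MillerForcing} (h : S ≤ restrict T t ht) : t ∈ S.1 := by
  obtain ⟨s, -, hs, hl⟩ := exists_splitNode_length S (nil_mem S) t.length
  rcases (h hs.1).2 with h' | h'
  · rw [← h'.eq_of_length (le_antisymm h'.length_le hl)]
    exact hs.1
  · exact mem_of_prefix h' hs.1

/-! ### Fusion -/

open Classical in
/-- The decreasing conditions used in a fusion, indexed by the reversed nodes: at every successor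
`t` of a splitnode the condition is restricted to `t`, and then shrunk by means of `e t`. -/
noncomputable def fusionSeq (T : MillerForcing) (e : List ℕ → MillerForcing → MillerForcing) :
    List ℕ → MillerForcing
  | [] => T
  | n :: l =>
    if h : IsSplitNode (fusionSeq T e l).1 l.reverse ∧ l.reverse ++ [n] ∈ (fusionSeq T e l).1 then
      e (l.reverse ++ [n]) (restrict (fusionSeq T e l) (l.reverse ++ [n]) h.2)
    else fusionSeq T e l

section Fusion

variable (T : MillerForcing) (e : List ℕ → MillerForcing → MillerForcing)

/-- The condition attached to the node `t` in a fusion. -/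
noncomputable def fusionAt (t : List ℕ) : MillerForcing := fusionSeq T e t.reverse

variable {T e}

theorem fusionAt_concat_pos {n : ℕ} (h : IsSplitNode (fusionAt T e t).1 t)
    (h' : t ++ [n] ∈ (fusionAt T e t).1) :
    fusionAt T e (t ++ [n]) = e (t ++ [n]) (restrict (fusionAt T e t) (t ++ [n]) h') := by
  simp only [fusionAt] at h h' ⊢
  simp only [List.reverse_append, List.reverse_cons, List.reverse_nil, List.nil_append,
    List.cons_append, fusionSeq, List.reverse_reverse]
  rw [dif_pos]
  rw [List.reverse_reverse]
  exact ⟨h, h'⟩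

theorem fusionAt_concat_neg {n : ℕ}
    (h : ¬ (IsSplitNode (fusionAt T e t).1 t ∧ t ++ [n] ∈ (fusionAt T e t).1)) :
    fusionAt T e (t ++ [n]) = fusionAt T e t := by
  simp only [fusionAt] at h ⊢
  simp only [List.reverse_append, List.reverse_cons, List.reverse_nil, List.nil_append,
    List.cons_append, fusionSeq, List.reverse_reverse]
  rw [dif_neg]
  rwa [List.reverse_reverse]

variable (he : ∀ t q, e t q ≤ q)
include he

theorem fusionAt_concat_le (t : List ℕ) (n : ℕ) : fusionAt T e (t ++ [n]) ≤ fusionAt T e t := by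
  by_cases h : IsSplitNode (fusionAt T e t).1 t ∧ t ++ [n] ∈ (fusionAt T e t).1
  · rw [fusionAt_concat_pos h.1 h.2]
    exact (he _ _).trans restrict_le
  · rw [fusionAt_concat_neg h]

theorem fusionAt_anti {s t : List ℕ} (h : s <+: t) : fusionAt T e t ≤ fusionAt T e s := by
  obtain ⟨z, rfl⟩ := h
  induction z using List.reverseRecOn with
  | nil => simp
  | append_singleton z a ih =>
    rw [← List.append_assoc]
    exact (fusionAt_concat_le he _ _).trans ih

theorem concat_mem_fusionAt {n : ℕ} (h : IsSplitNode (fusionAt T e t).1 t)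
    (h' : t ++ [n] ∈ (fusionAt T e t).1) : t ++ [n] ∈ (fusionAt T e (t ++ [n])).1 := by
  rw [fusionAt_concat_pos h h']
  exact mem_of_le_restrict (he _ _)

/-- From a node `t` up to the next splitnode of its attached condition, the attached conditions do
not change, so that splitnode survives. Its successors all survive too, because shrinking a
restriction to `t ++ [n]` cannot remove `t ++ [n]`. -/
theorem isMillerTree_fusion :
    IsMillerTree ⟨{t | t ∈ (fusionAt T e t).1}, fun t n h =>
      mem_of_prefix (List.prefix_append t [n]) (fusionAt_concat_le he t n h)⟩ where
  nonempty := ⟨[], nil_mem _⟩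
  increasing t ht := (fusionAt T e t).2.increasing t ht
  exists_split t ht := by
    obtain ⟨s, hts, hs, hmin⟩ := exists_minimal_splitNode _ ht
    have key : ∀ z, t ++ z <+: s → fusionAt T e (t ++ z) = fusionAt T e t := by
      intro z
      induction z using List.reverseRecOn with
      | nil => simp
      | append_singleton z a ih =>
        intro hz
        have hz' : t ++ z <+: s := List.IsPrefix.trans ⟨[a], by simp⟩ hz
        rw [← List.append_assoc, fusionAt_concat_neg, ih hz']
        rw [ih hz']
        refine fun H => hmin _ (List.prefix_append _ _) hz' (fun h => ?_) H.1
        have := hz.length_le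
        rw [← h] at this
        simp at this
    obtain ⟨z, rfl⟩ := hts
    have hQ := key z List.prefix_rfl
    rw [← hQ] at hs
    exact ⟨_, List.prefix_append _ _, hs.1,
      hs.2.mono fun n hn => concat_mem_fusionAt he hs hn⟩
  infinite_succ t ht := by
    have h : IsSplitNode (fusionAt T e t).1 t :=
      ⟨ht.1, ht.2.mono fun n hn => fusionAt_concat_le he t n hn⟩
    exact ((fusionAt T e t).2.infinite_succ t h).mono fun n hn => concat_mem_fusionAt he h hn

end Fusion

/-- Fusion: if below `T` the sets `D t` are open and dense, then `T` has an extension whose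
restriction to any immediate successor `t` of a splitnode is in `D t`. -/
theorem exists_fusion (T : MillerForcing) (D : List ℕ → MillerForcing → Prop)
    (hmono : ∀ t p q, q ≤ p → D t p → D t q) (hD : ∀ t, ∀ q ≤ T, ∃ r ≤ q, D t r) :
    ∃ S ≤ T, ∀ s n, IsSplitNode S.1 s → ∀ h : s ++ [n] ∈ S.1,
      D (s ++ [n]) (restrict S (s ++ [n]) h) := by
  -- The shrinking function is made total, acting trivially on conditions not below `T`.
  have : ∀ t q, ∃ r ≤ q, q ≤ T → D t r := fun t q => by
    by_cases hq : q ≤ T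
    · obtain ⟨r, hr, h⟩ := hD t q hq
      exact ⟨r, hr, fun _ => h⟩
    · exact ⟨q, le_rfl, fun h => absurd h hq⟩
  choose e he heD using this
  have hle : ∀ t, fusionAt T e t ≤ T := fun t => fusionAt_anti he (s := []) List.nil_prefix
  refine ⟨⟨_, isMillerTree_fusion (T := T) he⟩, fun t ht => hle t ht, fun s n hs h => ?_⟩
  have hs' : IsSplitNode (fusionAt T e s).1 s :=
    ⟨hs.1, hs.2.mono fun n hn => fusionAt_concat_le he s n hn⟩
  have hn : s ++ [n] ∈ (fusionAt T e s).1 := fusionAt_concat_le he s n h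
  refine hmono _ (fusionAt T e (s ++ [n])) _ ?_ ?_
  -- Nodes below `s ++ [n]` lie in its attached condition because `s ++ [n]` does; nodes above it
  -- because the attached conditions decrease.
  · rintro u ⟨hu, hc | hc⟩
    · exact mem_of_prefix hc h
    · exact fusionAt_anti he hc hu
  · rw [fusionAt_concat_pos hs' hn]
    exact heD _ _ (restrict_le.trans (hle s))

/-! ### Thinning out the successors of splitnodes -/

/-- Only choices at splitnodes of `T` are limited. From a surviving node the path to the next
splitnode of `T` is therefore intact, and infinitely many successors remain there. -/
theorem exists_thinning (T : MillerForcing) (R : List ℕ → ℕ → Prop)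
    (hR : ∀ s, IsSplitNode T.1 s → {n | s ++ [n] ∈ T.1 ∧ R s n}.Infinite) :
    ∃ S ≤ T, ∀ s n, IsSplitNode T.1 s → s ++ [n] ∈ S.1 → R s n := by
  let S : tree ℕ := ⟨{t | t ∈ T.1 ∧ ∀ s n, IsSplitNode T.1 s → s ++ [n] <+: t → R s n},
    fun t n h => ⟨mem_of_prefix (List.prefix_append _ _) h.1,
      fun s m hs hm => h.2 s m hs (hm.trans (List.prefix_append _ _))⟩⟩
  have hST : ∀ t, t ∈ S → t ∈ T.1 := fun t h => h.1
  have succ : ∀ s, s ∈ S → IsSplitNode T.1 s →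
      {n | s ++ [n] ∈ T.1 ∧ R s n} ⊆ {n | s ++ [n] ∈ S} := by
    intro s hs hs' n hn
    refine ⟨hn.1, fun u m hu hm => ?_⟩
    rcases List.prefix_concat_iff.1 hm with h | h
    · obtain ⟨rfl, h⟩ := List.append_inj' h rfl
      obtain rfl : m = n := by simpa using h
      exact hn.2
    · exact hs.2 u m hu h
  refine ⟨⟨S, ⟨[], nil_mem T, by simp⟩, fun s hs => T.2.increasing s hs.1, fun t ht => ?_,
    fun s hs => ?_⟩, hST, fun s n hs hn => hn.2 s n hs List.prefix_rfl⟩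
  · obtain ⟨s, hts, hs, hmin⟩ := exists_minimal_splitNode T ht.1
    have hsS : s ∈ S := by
      refine ⟨hs.1, fun u n hu hn => ?_⟩
      rcases List.prefix_or_prefix_of_prefix hn hts with h | h
      · exact ht.2 u n hu h
      · rcases List.prefix_concat_iff.1 h with rfl | h
        · exact ht.2 u n hu List.prefix_rfl
        · refine absurd hu (hmin u h ((List.prefix_append _ _).trans hn) fun he => ?_)
          have := hn.length_le
          simp [he] at this
    exact ⟨s, hts, hsS, ((hR s hs).mono (succ s hsS hs)).nontrivial⟩
  · have h := hs.mono hST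
    exact (hR s h).mono (succ s hs.1 h)

end MillerForcing

/-! ### Unbounded sequences -/

/-- Regularity of `ω₁`; successors are taken to make the bound strict. -/
theorem exists_forall_lt_of_countable {ι : Type} [Countable ι]
    (f : ι → (ω₁ : Ordinal.{0}).ToType) : ∃ γ, ∀ i, f i < γ := by
  refine ⟨Ordinal.ToType.mk ⟨⨆ i, Order.succ (f i : Ordinal.{0}),
    Ordinal.iSup_lt_omega_one fun i =>
      (Cardinal.isSuccLimit_omega 1).succ_lt (f i).toOrd.2⟩, fun i => ?_⟩
  rw [← OrderIso.symm_apply_lt]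
  exact Subtype.mk_lt_mk.2 ((Order.lt_succ (f i : Ordinal.{0})).trans_le <|
    Ordinal.le_iSup (fun i => Order.succ (f i : Ordinal.{0})) i)

namespace IsUnboundedSeq

variable {b : (ω₁ : Ordinal.{0}).ToType → ℕ → ℕ}

theorem eventually_le_of_le (hb : IsUnboundedSeq b) {α β : (ω₁ : Ordinal.{0}).ToType}
    (h : α ≤ β) : ∀ᶠ n in atTop, b α n ≤ b β n := by
  rcases h.eq_or_lt with rfl | h
  · exact Eventually.of_forall fun _ => le_rfl
  · exact hb.eventually_le _ _ h

/-- Let `g n` be an element of `A` above `n`. Some `b β` exceeds `F (g n)` for infinitely many `n`,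
and monotonicity carries the value at `n` up to `g n`. -/
theorem exists_infinite (hb : IsUnboundedSeq b) {A : Set ℕ} (hA : A.Infinite) (F : ℕ → ℕ) :
    ∃ β, ∀ γ, β ≤ γ → {n | n ∈ A ∧ F n ≤ b γ n}.Infinite := by
  choose g hg using fun k => hA.exists_gt k
  have : ∃ β, ¬ ∀ᶠ n in atTop, b β n ≤ F (g n) := by
    by_contra h
    push Not at h
    exact hb.not_bounded ⟨_, h⟩
  obtain ⟨β, hβ⟩ := this
  refine ⟨β, fun γ hγ => Set.infinite_of_not_bddAbove ?_⟩
  rintro ⟨N, hN⟩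
  apply hβ
  filter_upwards [hb.eventually_le_of_le hγ, eventually_ge_atTop N] with n hn hNn
  by_contra hlt
  have h1 : F (g n) ≤ b γ (g n) :=
    (not_le.1 hlt).le.trans (hn.trans (hb.monotone γ (hg n).2.le))
  have := hN ⟨(hg n).1, h1⟩
  have := (hg n).2
  omega

open MillerForcing in
/-- Every Miller tree can be thinned out so that a given function on its successors of splitnodes
is bounded by a member of a given unbounded sequence. -/
theorem exists_thinning (hb : IsUnboundedSeq b) (T : MillerForcing) (F : List ℕ → ℕ → ℕ) :
    ∃ β, ∃ S ≤ T, ∀ s n, IsSplitNode T.1 s → s ++ [n] ∈ S.1 → F s n ≤ b β n := by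
  have : ∀ s, ∃ β, IsSplitNode T.1 s →
      ∀ γ, β ≤ γ → {n | s ++ [n] ∈ T.1 ∧ F s n ≤ b γ n}.Infinite := fun s => by
    by_cases hs : IsSplitNode T.1 s
    · obtain ⟨β, h⟩ := hb.exists_infinite (T.2.infinite_succ s hs) (F s)
      exact ⟨β, fun _ => h⟩
    · obtain ⟨β, -⟩ := hb.exists_infinite Set.infinite_univ id
      exact ⟨β, fun h => absurd h hs⟩
  choose β hβ using this
  -- The property of `β s` persists to larger indices, so one index above them all works at every
  -- node.
  obtain ⟨γ, hγ⟩ := exists_forall_lt_of_countable β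
  exact ⟨γ, MillerForcing.exists_thinning T (fun s n => F s n ≤ b γ n)
    fun s hs => hβ s hs γ (hγ s).le⟩

open MillerForcing in
/-- Every Miller tree has a subtree such that `c α` is bounded by some `b β` at all sufficiently
large entries of its nodes. -/
theorem exists_dominating (hb : IsUnboundedSeq b) (T : MillerForcing) {f : ℕ → ℕ}
    (hf : Monotone f) : ∃ β, ∃ S ≤ T, ∃ K, ∀ s ∈ S.1, ∀ k ∈ s, K < k → f k ≤ b β k := by
  have : ∀ t, ∃ s, t ∈ T.1 → t <+: s ∧ IsSplitNode T.1 s ∧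
      ∀ u, t <+: u → u <+: s → u ≠ s → ¬ IsSplitNode T.1 u := fun t => by
    by_cases ht : t ∈ T.1
    · obtain ⟨s, hs⟩ := exists_minimal_splitNode T ht
      exact ⟨s, fun _ => hs⟩
    · exact ⟨[], fun h => absurd h ht⟩
  choose next hnext using this
  -- The sum of a node bounds all its entries.
  obtain ⟨β, S, hST, hS⟩ := hb.exists_thinning T fun s n => f (next (s ++ [n])).sum
  refine ⟨β, S, hST, (next []).sum, fun s hs k hk hKk => ?_⟩
  obtain ⟨u, v, rfl⟩ := List.append_of_mem hk
  have hukS : u ++ [k] ∈ S.1 := mem_of_prefix ⟨v, by simp⟩ hs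
  have huk := hST hukS
  -- Without a splitnode between `t` and `u`, the splitnode `next t` extends `u ++ [k]` and so has
  -- `k` among its entries.
  have key : ∀ t, t ∈ T.1 → t <+: u ++ [k] →
      (∀ x, t <+: x → x <+: u → ¬ IsSplitNode T.1 x) → k ≤ (next t).sum := by
    intro t ht htu hns
    obtain ⟨h1, h2, -⟩ := hnext t ht
    have h3 : u ++ [k] <+: next t := by
      refine prefix_of_forall_not_splitNode huk h2.1 htu h1 (fun x hx hxu hne => ?_) fun h => ?_
      · exact hns x hx ((List.prefix_concat_iff.1 hxu).resolve_left hne)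
      · exact (List.prefix_concat_iff.1 h).resolve_right fun h => hns _ h1 h h2
    exact List.le_sum_of_mem (h3.subset (by simp))
  by_cases hex : ∃ x, x <+: u ∧ IsSplitNode T.1 x
  · classical
    have hbd : ∀ l, (∃ x, x <+: u ∧ IsSplitNode T.1 x ∧ x.length = l) → l ≤ u.length := by
      rintro _ ⟨x, hx, -, rfl⟩
      exact hx.length_le
    obtain ⟨x, hxu, hx⟩ := hex
    -- The last splitnode `w` of `T` along `u`: its successor `n` towards `k` is the choice that
    -- determines the stretch containing `k`.
    obtain ⟨w, hwu, hw, hwl⟩ := Nat.findGreatest_spec (P := fun l =>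
      ∃ x, x <+: u ∧ IsSplitNode T.1 x ∧ x.length = l) (hbd _ ⟨x, hxu, hx, rfl⟩) ⟨x, hxu, hx, rfl⟩
    have hmax : ∀ y, y <+: u → IsSplitNode T.1 y → y.length ≤ w.length := by
      intro y hy hy'
      rw [hwl]
      exact Nat.le_findGreatest (hbd _ ⟨y, hy, hy', rfl⟩) ⟨y, hy, hy', rfl⟩
    have hn : ∃ n, w ++ [n] <+: u ++ [k] := by
      obtain ⟨z, rfl⟩ := hwu
      match z with
      | [] => exact ⟨k, by simp⟩
      | n :: z => exact ⟨n, by simp⟩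
    obtain ⟨n, hn⟩ := hn
    have hnS := mem_of_prefix hn hukS
    have hkn := key _ (hST hnS) hn fun y hy hyu hys => by
      have h1 := hmax y hyu hys
      have h2 := hy.length_le
      simp at h2
      omega
    have hnk : n ≤ k := by
      have hinc := T.2.increasing _ huk
      have hmem : n ∈ u ++ [k] := hn.subset (by simp)
      rcases List.mem_append.1 hmem with h | h
      · exact ((List.pairwise_append.1 hinc).2.2 n h k (by simp)).le
      · exact (List.mem_singleton.1 h).le
    exact (hf hkn).trans ((hS w n hw hnS).trans (hb.monotone β hnk))
  -- Here `k` is reached before any choice is made, so it is at most the bound for the first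
  -- stretch.
  · have := key [] (nil_mem T) List.nil_prefix fun x _ hx hs => hex ⟨x, hx, hs⟩
    omega

end IsUnboundedSeq

/-! ## Natural numbers and ordinals as pre-sets -/

namespace PSet

theorem mem_ofNat {x : PSet.{0}} {n : ℕ} :
    x ∈ ofNat.{0} n ↔ ∃ m < n, PSet.Equiv x (ofNat.{0} m) := by
  induction n with
  | zero => simp [ofNat]
  | succ n ih =>
    rw [ofNat, mem_insert_iff, ih]
    constructor
    · rintro (h | ⟨m, hm, h⟩)
      · exact ⟨n, n.lt_succ_self, h⟩
      · exact ⟨m, hm.trans n.lt_succ_self, h⟩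
    · rintro ⟨m, hm, h⟩
      rcases Nat.lt_succ_iff_lt_or_eq.1 hm with hm | rfl
      · exact Or.inr ⟨m, hm, h⟩
      · exact Or.inl h

theorem equiv_ofNat {m n : ℕ} : PSet.Equiv (ofNat.{0} m) (ofNat.{0} n) ↔ m = n := by
  refine ⟨fun h => ?_, fun h => h ▸ Equiv.rfl⟩
  rcases lt_trichotomy m n with hmn | hmn | hmn
  · exact absurd ((Mem.congr_right h).2 (mem_ofNat.2 ⟨m, hmn, Equiv.rfl⟩)) (mem_irrefl _)
  · exact hmn
  · exact absurd ((Mem.congr_right h).1 (mem_ofNat.2 ⟨n, hmn, Equiv.rfl⟩)) (mem_irrefl _)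

theorem ofNat_mem_ofNat {m n : ℕ} : ofNat.{0} m ∈ ofNat.{0} n ↔ m < n := by
  rw [mem_ofNat]
  constructor
  · rintro ⟨k, hk, h⟩
    rwa [equiv_ofNat.1 h]
  · exact fun h => ⟨m, h, Equiv.rfl⟩

theorem equiv_toPSet {α β : Ordinal.{0}} : PSet.Equiv α.toPSet β.toPSet ↔ α = β := by
  refine ⟨fun h => ?_, fun h => h ▸ Equiv.rfl⟩
  simpa using rank_congr h

theorem toPSet_mem_toPSet {α β : Ordinal.{0}} : α.toPSet ∈ β.toPSet ↔ α < β := by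
  rw [Ordinal.mem_toPSet_iff]
  constructor
  · rintro ⟨k, hk, h⟩
    rwa [equiv_toPSet.1 h]
  · exact fun h => ⟨α, h, Equiv.rfl⟩

theorem equiv_toPSet_toType {o : Ordinal.{0}} {α β : o.ToType} :
    PSet.Equiv (α : Ordinal.{0}).toPSet (β : Ordinal.{0}).toPSet ↔ α = β := by
  rw [equiv_toPSet]
  exact Subtype.val_injective.eq_iff.trans Ordinal.ToType.mk.symm.injective.eq_iff

theorem toPSet_mem_toPSet_toType {o : Ordinal.{0}} {α β : o.ToType} :
    (α : Ordinal.{0}).toPSet ∈ (β : Ordinal.{0}).toPSet ↔ α < β := by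
  rw [toPSet_mem_toPSet]
  exact Ordinal.ToType.mk.symm.lt_iff_lt (x := α) (y := β)

end PSet

/-! ### Evaluating formulas at canonical names -/

namespace PName

variable {P : Type} [Preorder P] [OrderTop P]

namespace Ext

variable {A B X : PName P → PName P}

theorem singleValued (hA : Resp A) : Ext fun x => PName.singleValued (A x) :=
  all fun _ => all fun _ => all fun _ =>
    imp (mem (.const _) hA) (imp (mem (.const _) hA) (eq (.const _) (.const _)))

theorem isReal (hA : Resp A) : Ext fun x => PName.isReal (A x) :=
  and (ballIn hA fun _ => bexIn (.const _) fun _ => bexIn (.const _) fun _ =>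
      eq (.const _) (.const _))
    (and (ballIn (.const _) fun _ => bexIn (.const _) fun _ => mem (.const _) hA)
      (singleValued hA))

theorem isCountable (hA : Resp A) : Ext fun x => PName.isCountable (A x) :=
  ex fun _ => and (singleValued (.const _)) (ballIn hA fun _ => bexIn (.const _) fun _ =>
    mem (.const _) (.const _))

theorem isIncreasing (hA : Resp A) : Ext fun x => PName.isIncreasing (A x) :=
  ballIn (.const _) fun _ => ballIn (.const _) fun _ => imp (mem (.const _) (.const _))
    (all fun _ => all fun _ => imp (mem (.const _) hA) (imp (mem (.const _) hA)
      (le (.const _) (.const _))))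

theorem evDomOn (hX : Resp X) (hA : Resp A) (hB : Resp B) :
    Ext fun x => PName.evDomOn (X x) (A x) (B x) :=
  bexIn (.const _) fun _ => ballIn hX fun _ => imp (mem (.const _) (.const _))
    (all fun _ => all fun _ => imp (mem (.const _) hA) (imp (mem (.const _) hB)
      (le (.const _) (.const _))))

end Ext

/-! ### Canonical names of reals and of sequences of reals -/

theorem ofNat_mem_ofNat {m n : ℕ} {p : P} :
    mem (check (PSet.ofNat m)) (check (PSet.ofNat n)) p ↔ m < n := by
  rw [check_mem_check, PSet.ofNat_mem_ofNat]

theorem ofNat_le_ofNat {m n : ℕ} {p : P} :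
    le (check (PSet.ofNat m)) (check (PSet.ofNat n)) p ↔ m ≤ n := by
  have key : ∀ q : P, mem (check (PSet.ofNat m)) (check (PSet.ofNat n)) q ∨
      eq (check (PSet.ofNat m)) (check (PSet.ofNat n)) q ↔ m ≤ n := fun q => by
    rw [ofNat_mem_ofNat, eq_check, PSet.equiv_ofNat, le_iff_lt_or_eq]
  constructor
  · intro h
    obtain ⟨r, -, h⟩ := h p le_rfl
    exact (key r).1 h
  · exact fun h q _ => ⟨q, le_rfl, (key q).2 h⟩

theorem pair_ofNat_mem_ofReal {f : ℕ → ℕ} {n : ℕ} {y : PName P} {p : P} :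
    mem (pair (check (PSet.ofNat n)) y) (check (PSet.ofReal f)) p ↔
      eq y (check (PSet.ofNat (f n))) p :=
  ⟨eq_of_pair_mem_check (X := PSet.ofNat) fun _ _ => PSet.equiv_ofNat.1,
    fun h => mem_congr_left (eq_pair (eq_refl _ _) (eq_symm h))
      (pair_mem_check_intro (X := PSet.ofNat) (Y := fun n => PSet.ofNat (f n)) n p)⟩

theorem isReal_ofReal (f : ℕ → ℕ) (p : P) : isReal (check (PSet.ofReal f)) p := by
  refine ⟨?_, ?_, singleValued_check (X := PSet.ofNat) (fun _ _ => PSet.equiv_ofNat.1) p⟩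
  · rw [ballIn_check (Ext.bexIn (.const _) fun _ => Ext.bexIn (.const _) fun _ =>
      Ext.eq .id (.const _))]
    intro n
    refine bexIn_omega_intro (Ext.bexIn (.const _) fun _ => Ext.eq (.const _) (.pair .id (.const _)))
      n ?_
    refine bexIn_omega_intro (Ext.eq (.const _) (.pair (.const _) .id)) (f n) ?_
    exact eq_check_kpair _ _ _
  · rw [ballIn_omega (Ext.bexIn (.const _) fun _ => Ext.mem (.pair .id (.const _)) (.const _))]
    intro n
    refine bexIn_omega_intro (Ext.mem (.pair (.const _) .id) (.const _)) (f n) ?_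
    exact pair_ofNat_mem_ofReal.2 (eq_refl _ _)

theorem isIncreasing_ofReal {f : ℕ → ℕ} (hf : Monotone f) (p : P) :
    isIncreasing (check (PSet.ofReal f)) p := by
  rw [isIncreasing, ballIn_omega (Ext.ballIn (.const _) fun _ => Ext.imp (.mem .id (.const _))
    (.all fun _ => .all fun _ => .imp (.mem (.pair .id (.const _)) (.const _))
      (.imp (.mem (.const _) (.const _)) (.le (.const _) (.const _)))))]
  intro m
  rw [ballIn_omega (Ext.imp (.mem (.const _) .id)
    (.all fun _ => .all fun _ => .imp (.mem (.const _) (.const _))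
      (.imp (.mem (.pair .id (.const _)) (.const _)) (.le (.const _) (.const _)))))]
  intro n q _ hmn k l q' hq' hk q'' hq'' hl
  rw [ofNat_mem_ofNat] at hmn
  rw [pair_ofNat_mem_ofReal] at hk hl
  refine (Ext.le (.const _) .id).congr (eq_symm hl) ?_
  refine (Ext.le .id (.const _)).congr (eq_symm (eq_mono hq'' hk)) ?_
  exact ofNat_le_ofNat.2 (hf hmn.le)

/-- A sufficient condition for eventual domination of ground model reals on a name `x` of a
subset of `ω`. -/
theorem evDomOn_ofReal {x : PName P} {f g : ℕ → ℕ} {p : P} (K : ℕ)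
    (h : ∀ q ≤ p, ∀ y, mem y x q → ∀ q' ≤ q, ∃ r ≤ q', ∃ n, eq y (check (PSet.ofNat n)) r ∧
      (K < n → f n ≤ g n)) :
    evDomOn x (check (PSet.ofReal f)) (check (PSet.ofReal g)) p := by
  refine bexIn_omega_intro (Ext.ballIn (.const _) fun _ => Ext.imp (.mem .id (.const _))
    (.all fun _ => .all fun _ => .imp (.mem (.const _) (.const _))
      (.imp (.mem (.const _) (.const _)) (.le (.const _) (.const _))))) K ?_
  intro y q hq hy q' hq' hK l m s hs hl s' hs' hm
  -- The formula does not depend on the variable, so the name put in for it is immaterial.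
  refine (Ext.le (.const _) (.const _)).dense (x := y) fun u hu => ?_
  have hu' := hu.trans hs'
  obtain ⟨r, hr, n, hn, hfg⟩ := h q hq y hy u (hu'.trans (hs.trans hq'))
  have hru := hr.trans hu'
  have hK' := ofNat_mem_ofNat.1 (mem_congr_right hn (mem_mono (hru.trans hs) hK))
  have hl' := pair_ofNat_mem_ofReal.1
    (mem_congr_left (eq_pair hn (eq_refl _ _)) (mem_mono hru hl))
  have hm' := pair_ofNat_mem_ofReal.1
    (mem_congr_left (eq_pair hn (eq_refl _ _)) (mem_mono (hr.trans hu) hm))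
  refine ⟨r, hr, (Ext.le (.const _) .id).congr (eq_symm hm') ?_⟩
  refine (Ext.le .id (.const _)).congr (eq_symm hl') ?_
  exact ofNat_le_ofNat.2 (hfg hK')

theorem evDomOn_omega_ofReal {f g : ℕ → ℕ} (h : ∀ᶠ n in atTop, f n ≤ g n) (p : P) :
    evDomOn omega (check (PSet.ofReal f)) (check (PSet.ofReal g)) p := by
  obtain ⟨K, hK⟩ := eventually_atTop.1 h
  refine evDomOn_ofReal K fun q _ y hy q' hq' => ?_
  obtain ⟨r, hr, n, hn⟩ := mem_check.1 hy q' hq'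
  exact ⟨r, hr, n.down, hn, fun h => hK _ h.le⟩

/-- Extending the condition decides the threshold `K`; afterwards any value of `h` decided by a
stronger condition can be compared with `f` in the ground model. -/
theorem exists_of_evDomOn_omega {f : ℕ → ℕ} {h : PName P} {p : P}
    (H : evDomOn omega (check (PSet.ofReal f)) h p) :
    ∃ r ≤ p, ∃ K, ∀ n, K < n → ∀ s ≤ r, ∀ v,
      mem (pair (check (PSet.ofNat n)) (check (PSet.ofNat v))) h s → f n ≤ v := by
  obtain ⟨r, hr, K, hK⟩ := exists_of_bexIn_omega (Ext.ballIn (.const _) fun _ => Ext.imp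
    (.mem .id (.const _)) (.all fun _ => .all fun _ => .imp (.mem (.const _) (.const _))
      (.imp (.mem (.const _) (.const _)) (.le (.const _) (.const _))))) H
  refine ⟨r, hr, K, fun n hn s hs v hv => ?_⟩
  rw [ballIn_omega (Ext.imp (.mem (.const _) .id)
    (.all fun _ => .all fun _ => .imp (.mem (.pair .id (.const _)) (.const _))
      (.imp (.mem (.pair .id (.const _)) (.const _)) (.le (.const _) (.const _)))))] at hK
  exact ofNat_le_ofNat.1 (hK n r le_rfl (ofNat_mem_ofNat.2 hn) (check (PSet.ofNat (f n))) _ s hs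
    (pair_ofNat_mem_ofReal.2 (eq_refl _ _)) s le_rfl hv)

theorem ballIn_toPSet {φ : PName P → FSent P} (hφ : Ext φ) {o : Ordinal.{0}} {p : P} :
    ballIn (check o.toPSet) φ p ↔
      ∀ α : o.ToType, φ (check (α : Ordinal.{0}).toPSet) p := by
  rw [Ordinal.toPSet, ballIn_check hφ]
  rfl

theorem bexIn_toPSet_intro {φ : PName P → FSent P} (hφ : Ext φ) {o : Ordinal.{0}} {p : P}
    (α : o.ToType) (h : φ (check (α : Ordinal.{0}).toPSet) p) : bexIn (check o.toPSet) φ p := by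
  rw [Ordinal.toPSet]
  exact bexIn_check_intro hφ (x := ⟨o.ToType, fun α => (α : Ordinal.{0}).toPSet⟩) α h

theorem isTransitive_toPSet (o : Ordinal.{0}) (p : P) : isTransitive (check o.toPSet) p := by
  rw [isTransitive, ballIn_toPSet (Ext.ballIn .id fun _ => Ext.mem (.const _) (.const _))]
  intro α
  rw [ballIn_toPSet (Ext.mem .id (.const _))]
  intro β
  rw [check_mem_check, PSet.toPSet_mem_toPSet]
  exact (Set.mem_Iio.1 β.toOrd.2).trans α.toOrd.2

theorem isOrdinal_toPSet (o : Ordinal.{0}) (p : P) : isOrdinal (check o.toPSet) p :=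
  ⟨isTransitive_toPSet o p,
    (ballIn_toPSet (Ext.isTransitive .id)).2 fun _ => isTransitive_toPSet _ p⟩

theorem isCountable_toPSet {o : Ordinal.{0}} (ho : o < ω₁) (p : P) :
    isCountable (check o.toPSet) p := by
  have : Countable o.ToType := by
    rw [← Cardinal.mk_le_aleph0_iff, Cardinal.mk_toType, ← Cardinal.lt_aleph_one_iff]
    rw [← Cardinal.ord_aleph] at ho
    exact Cardinal.lt_ord.1 ho
  obtain ⟨e, he⟩ := Countable.exists_injective_nat o.ToType
  refine ex_intro (check ⟨o.ToType, fun α =>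
    PSet.kpair (PSet.ofNat (e α)) (α : Ordinal.{0}).toPSet⟩) fun q _ => ⟨?_, ?_⟩
  · exact singleValued_check (fun α β h => he (PSet.equiv_ofNat.1 h)) q
  · rw [ballIn_toPSet (Ext.bexIn (.const _) fun _ => Ext.mem (.pair (.const _) .id) (.const _))]
    exact fun α => bexIn_omega_intro (Ext.mem (.pair .id (.const _)) (.const _)) (e α)
      (pair_mem_check_intro (X := fun α => PSet.ofNat (e α)) α q)

section Seq

variable {b : (ω₁ : Ordinal.{0}).ToType → ℕ → ℕ}

theorem pair_toPSet_mem_ofSeq {α : (ω₁ : Ordinal.{0}).ToType} {y : PName P} {p : P} :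
    mem (pair (check (α : Ordinal.{0}).toPSet) y) (check (PSet.ofSeq b)) p ↔
      eq y (check (PSet.ofReal (b α))) p :=
  ⟨eq_of_pair_mem_check (X := fun α : (ω₁ : Ordinal.{0}).ToType => (α : Ordinal.{0}).toPSet)
      fun _ _ => PSet.equiv_toPSet_toType.1,
    fun h => mem_congr_left (eq_pair (eq_refl _ _) (eq_symm h))
      (pair_mem_check_intro (X := fun α : (ω₁ : Ordinal.{0}).ToType => (α : Ordinal.{0}).toPSet)
        (Y := fun α => PSet.ofReal (b α)) α p)⟩

theorem isSeqOfReals_ofSeq (b : (ω₁ : Ordinal.{0}).ToType → ℕ → ℕ) (p : P) :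
    isSeqOfReals (check (ω₁ : Ordinal.{0}).toPSet) (check (PSet.ofSeq b)) p := by
  refine ⟨?_, ?_, singleValued_check
    (X := fun α : (ω₁ : Ordinal.{0}).ToType => (α : Ordinal.{0}).toPSet)
    (fun _ _ => PSet.equiv_toPSet_toType.1) p⟩
  · rw [ballIn_check (Ext.bexIn (.const _) fun _ => Ext.ex fun _ =>
      Ext.and (.isReal (.const _)) (.eq .id (.const _)))]
    intro α
    refine bexIn_toPSet_intro (Ext.ex fun _ => Ext.and (.isReal (.const _))
      (.eq (.const _) (.pair .id (.const _)))) α ?_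
    exact ex_intro (check (PSet.ofReal (b α))) fun q _ => ⟨isReal_ofReal _ _, eq_check_kpair _ _ _⟩
  · rw [ballIn_toPSet (Ext.ex fun _ => Ext.mem (.pair .id (.const _)) (.const _))]
    exact fun α => ex_intro (check (PSet.ofReal (b α))) fun q _ =>
      pair_toPSet_mem_ofSeq.2 (eq_refl _ _)

theorem ofSeq_isIncreasing (hb : IsUnboundedSeq b) (p : P) :
    (ballIn (check (ω₁ : Ordinal.{0}).toPSet) fun α => all fun f =>
      mem (pair α f) (check (PSet.ofSeq b)) ⟾ isIncreasing f) p := by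
  rw [ballIn_toPSet (Ext.all fun _ => Ext.imp (.mem (.pair .id (.const _)) (.const _))
    (.isIncreasing (.const _)))]
  intro α f q _ hf
  exact (Ext.isIncreasing .id).congr (eq_symm (pair_toPSet_mem_ofSeq.1 hf))
    (isIncreasing_ofReal (hb.monotone α) q)

theorem ofSeq_evDomOn (hb : IsUnboundedSeq b) (p : P) :
    (ballIn (check (ω₁ : Ordinal.{0}).toPSet) fun α =>
      ballIn (check (ω₁ : Ordinal.{0}).toPSet) fun β => mem α β ⟾ all fun f => all fun g =>
        mem (pair α f) (check (PSet.ofSeq b)) ⟾ mem (pair β g) (check (PSet.ofSeq b)) ⟾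
          evDomOn omega f g) p := by
  rw [ballIn_toPSet (Ext.ballIn (.const _) fun _ => Ext.imp (.mem .id (.const _)) (.all fun _ =>
    .all fun _ => .imp (.mem (.pair .id (.const _)) (.const _)) (.imp (.mem (.const _) (.const _))
      (.evDomOn (.const _) (.const _) (.const _)))))]
  intro α
  rw [ballIn_toPSet (Ext.imp (.mem (.const _) .id) (.all fun _ =>
    .all fun _ => .imp (.mem (.const _) (.const _)) (.imp (.mem (.pair .id (.const _)) (.const _))
      (.evDomOn (.const _) (.const _) (.const _)))))]
  intro β q _ hαβ f g q' _ hf q'' hq'' hg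
  rw [check_mem_check, PSet.toPSet_mem_toPSet_toType] at hαβ
  refine (Ext.evDomOn (.const _) .id (.const _)).congr
    (eq_symm (eq_mono hq'' (pair_toPSet_mem_ofSeq.1 hf))) ?_
  refine (Ext.evDomOn (.const _) (.const _) .id).congr (eq_symm (pair_toPSet_mem_ofSeq.1 hg)) ?_
  exact evDomOn_omega_ofReal (hb.eventually_le α β hαβ) q''

end Seq

end PName

/-! ### Preservation of `ω₁` and of unboundedness -/

namespace MillerForcing

open PName

/-- Miller forcing preserves `ω₁`. -/
theorem not_isCountable_omega_one (p : MillerForcing) :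
    FSent.not (isCountable (check (ω₁ : Ordinal.{0}).toPSet)) p := by
  intro q _ hq
  obtain ⟨T, -, h, hsv, hran⟩ := exists_of_ex hq
  -- The condition `q` decides the value of `h` at `i`, or that `h` has no value below `ω₁` there.
  let E : ℕ → MillerForcing → Prop := fun i q =>
    (∃ α : (ω₁ : Ordinal.{0}).ToType,
      mem (pair (check (PSet.ofNat i)) (check (α : Ordinal.{0}).toPSet)) h q) ∨
    ∀ α : (ω₁ : Ordinal.{0}).ToType, ∀ r ≤ q,
      ¬ mem (pair (check (PSet.ofNat i)) (check (α : Ordinal.{0}).toPSet)) h r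
  have hEmono : ∀ i p q, q ≤ p → E i p → E i q := fun i p q hqp hp =>
    hp.imp (fun ⟨α, h⟩ => ⟨α, mem_mono hqp h⟩) fun h α r hr => h α r (hr.trans hqp)
  have hEdense : ∀ k q, ∃ r ≤ q, ∀ i < k, E i r := by
    intro k
    induction k with
    | zero => exact fun q => ⟨q, le_rfl, by simp⟩
    | succ k ih =>
      intro q
      obtain ⟨r, hr, hk⟩ := ih q
      have : ∃ s ≤ r, E k s := by
        by_cases hex : ∃ α : (ω₁ : Ordinal.{0}).ToType, ∃ s ≤ r,
            mem (pair (check (PSet.ofNat k)) (check (α : Ordinal.{0}).toPSet)) h s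
        · obtain ⟨α, s, hs, hm⟩ := hex
          exact ⟨s, hs, Or.inl ⟨α, hm⟩⟩
        · exact ⟨r, le_rfl, Or.inr fun α s hs hm => hex ⟨α, s, hs, hm⟩⟩
      obtain ⟨s, hs, hEs⟩ := this
      refine ⟨s, hs.trans hr, fun i hi => ?_⟩
      rcases Nat.lt_succ_iff_lt_or_eq.1 hi with hi | rfl
      · exact hEmono i r s hs (hk i hi)
      · exact hEs
  -- Each `i` is thus decided at all sufficiently long successors of splitnodes.
  obtain ⟨S, hST, hS⟩ := exists_fusion T (fun t q => ∀ i < t.length, E i q)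
    (fun t p q hqp hp i hi => hEmono i p q hqp (hp i hi)) fun t q _ => hEdense t.length q
  have : ∀ x : List ℕ × ℕ, ∃ α : (ω₁ : Ordinal.{0}).ToType, ∀ hx : x.1 ∈ S.1,
      (∃ β : (ω₁ : Ordinal.{0}).ToType, mem (pair (check (PSet.ofNat x.2))
        (check (β : Ordinal.{0}).toPSet)) h (restrict S x.1 hx)) →
      mem (pair (check (PSet.ofNat x.2)) (check (α : Ordinal.{0}).toPSet)) h
        (restrict S x.1 hx) := fun x => by
    by_cases hex : ∃ hx : x.1 ∈ S.1, ∃ β : (ω₁ : Ordinal.{0}).ToType,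
      mem (pair (check (PSet.ofNat x.2)) (check (β : Ordinal.{0}).toPSet)) h (restrict S x.1 hx)
    · obtain ⟨hx, β, hβ⟩ := hex
      exact ⟨β, fun _ _ => hβ⟩
    · obtain ⟨γ, -⟩ := exists_forall_lt_of_countable (ι := Empty) nofun
      exact ⟨γ, fun hx hβ => absurd ⟨hx, hβ⟩ hex⟩
  choose g hg using this
  -- There are countably many pairs of a node and an argument, so `α` differs from every decided
  -- value.
  obtain ⟨α, hα⟩ := exists_forall_lt_of_countable g
  rw [ballIn_toPSet (Ext.bexIn (.const _) fun _ => Ext.mem (.pair (.const _) .id) (.const _))]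
    at hran
  obtain ⟨r, hr, i, hi⟩ := exists_of_bexIn_omega (Ext.mem (.pair .id (.const _)) (.const _))
    ((Ext.bexIn (.const _) fun _ => Ext.mem (.const _) (.const _)).mono (x := h) hST (hran α))
  obtain ⟨s, -, hs, hl⟩ := exists_splitNode_length r (nil_mem r) i
  obtain ⟨n, hn⟩ := hs.2.nonempty
  have hle := restrict_le_restrict hr hn
  rcases hS s n (hs.mono hr) (hr hn) i (by simp; omega) with hβ | hno
  · have h1 := mem_mono hle (hg (s ++ [n], i) (hr hn) hβ)
    have h2 := mem_mono (restrict_le (ht := hn)) hi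
    have h3 := hsv _ _ _ _ (restrict_le.trans (hr.trans hST)) h1 _ le_rfl h2
    rw [eq_check, PSet.equiv_toPSet_toType] at h3
    exact (hα (s ++ [n], i)).ne h3
  · exact hno α _ hle (mem_mono restrict_le hi)

theorem isOmegaOne_omega_one (p : MillerForcing) :
    isOmegaOne (check (ω₁ : Ordinal.{0}).toPSet) p :=
  ⟨isOrdinal_toPSet _ p, not_isCountable_omega_one p,
    (ballIn_toPSet (Ext.isCountable .id)).2 fun α => isCountable_toPSet α.toOrd.2 p⟩

variable {b c : (ω₁ : Ordinal.{0}).ToType → ℕ → ℕ}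

/-- Miller forcing does not add an upper bound to an unbounded sequence. -/
theorem not_bounded_ofSeq (hb : IsUnboundedSeq b) (p : MillerForcing) :
    FSent.not (ex fun h => isReal h ⩕ ballIn (check (ω₁ : Ordinal.{0}).toPSet) fun α =>
      all fun f => mem (pair α f) (check (PSet.ofSeq b)) ⟾ evDomOn omega f h) p := by
  intro q _ hq
  obtain ⟨T, -, h, hreal, hdom⟩ := exists_of_ex hq
  have htot := hreal.2.1
  rw [ballIn_omega (Ext.bexIn (.const _) fun _ => Ext.mem (.pair .id (.const _)) (.const _))]
    at htot
  obtain ⟨S, hST, hS⟩ := exists_fusion T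
    -- At `t = s ++ [n]` this decides `h` at `n`; the default `0` concerns only the empty node,
    -- which is no successor.
    (fun t q => ∃ v, mem (pair (check (PSet.ofNat (t.getLastD 0))) (check (PSet.ofNat v))) h q)
    (fun t p q hqp hp => hp.imp fun v => mem_mono hqp) fun t q hq =>
      exists_of_bexIn_omega (Ext.mem (.pair (.const _) .id) (.const _))
        ((Ext.bexIn (.const _) fun _ => Ext.mem (.const _) (.const _)).mono (x := h) hq
          (htot (t.getLastD 0)))
  have : ∀ s n, ∃ v, IsSplitNode S.1 s → ∀ hn : s ++ [n] ∈ S.1,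
      mem (pair (check (PSet.ofNat n)) (check (PSet.ofNat v))) h (restrict S (s ++ [n]) hn) := by
    intro s n
    by_cases hsn : IsSplitNode S.1 s ∧ s ++ [n] ∈ S.1
    · obtain ⟨v, hv⟩ := hS s n hsn.1 hsn.2
      rw [List.getLastD_concat] at hv
      exact ⟨v, fun _ _ => hv⟩
    · exact ⟨0, fun hs hn => absurd ⟨hs, hn⟩ hsn⟩
  choose F hF using this
  -- The added `1` makes `b α n` strictly larger than the decided value.
  obtain ⟨α, S', hS', hFS⟩ := hb.exists_thinning S fun s n => F s n + 1
  rw [ballIn_toPSet (Ext.all fun _ => Ext.imp (.mem (.pair .id (.const _)) (.const _))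
    (.evDomOn (.const _) (.const _) (.const _)))] at hdom
  obtain ⟨r, hr, K, hK⟩ := exists_of_evDomOn_omega
    (hdom α (check (PSet.ofReal (b α))) S' (hS'.trans hST)
      (pair_toPSet_mem_ofSeq.2 (eq_refl _ _)))
  obtain ⟨s, -, hs, -⟩ := exists_splitNode_length r (nil_mem r) 0
  obtain ⟨n, hn, hKn⟩ := (r.2.infinite_succ s hs).exists_gt K
  have hrS := hr.trans hS'
  have hsS := hs.mono hrS
  have h1 := hK n hKn _ restrict_le (F s n)
    (mem_mono (restrict_le_restrict hrS hn) (hF s n hsS (hrS hn)))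
  have h2 := hFS s n hsS (hr hn)
  omega

theorem isUnbounded_ofSeq (hb : IsUnboundedSeq b) (p : MillerForcing) :
    isUnbounded (check (ω₁ : Ordinal.{0}).toPSet) (check (PSet.ofSeq b)) p :=
  ⟨isSeqOfReals_ofSeq b p, ofSeq_isIncreasing hb p, ofSeq_evDomOn hb p, not_bounded_ofSeq hb p⟩

/-! ### The range of the Miller real -/

theorem memRange_mono {n : ℕ} {p q : MillerForcing} (hq : q ≤ p) (h : memRange n p) :
    memRange n q := fun r hr => h r (hr.trans hq)

theorem exists_mem_of_memRange {n : ℕ} {p : MillerForcing} (h : memRange n p) :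
    ∃ r ≤ p, ∃ s ∈ r.1, n ∈ s := by
  obtain ⟨r, hr, s, hs, hn⟩ := h p le_rfl
  -- The condition `r` forces itself into the generic filter, so `s` must be a node of `r`.
  exact ⟨r, hr, s, hs r r le_rfl fun q hq => ⟨q, le_rfl, hq⟩, hn⟩

/-- A tree forced into the generic filter has a common extension with the restriction, and that
extension contains `t`. -/
theorem memRange_restrict {T : MillerForcing} {t : List ℕ} {ht : t ∈ T.1} {n : ℕ} (hn : n ∈ t) :
    memRange n (restrict T t ht) := by
  refine fun q hq => ⟨q, le_rfl, t, fun S r hr hS => ?_, hn⟩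
  obtain ⟨u, hu, huS⟩ := hS r le_rfl
  exact huS (mem_of_le_restrict (hu.trans (hr.trans hq)))

theorem exists_of_mem_rangeName {y : PName MillerForcing} {p : MillerForcing}
    (h : mem y rangeName p) : ∃ r ≤ p, ∃ n, memRange n r ∧ eq y (check (PSet.ofNat n)) r := by
  obtain ⟨r, hr, ⟨⟨n, q⟩, hq⟩, hrq, e⟩ := mem_mk.1 h p le_rfl
  exact ⟨r, hr, n, memRange_mono hrq hq, e⟩

theorem mem_rangeName {n : ℕ} {p : MillerForcing} (h : memRange n p) :
    mem (check (PSet.ofNat n)) rangeName p :=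
  mem_mk.2 fun q hq => ⟨q, le_rfl, ⟨⟨n, p⟩, h⟩, hq, eq_refl _ _⟩

theorem isInfiniteSubset_rangeName (p : MillerForcing) : isInfiniteSubset rangeName p := by
  constructor
  · intro y q _ hy
    refine mem_local fun q' hq' => ?_
    obtain ⟨r, hr, n, -, e⟩ := exists_of_mem_rangeName (mem_mono hq' hy)
    exact ⟨r, hr, mem_congr_left (eq_symm e) (check_mem_check.2 ⟨⟨n⟩, .rfl⟩)⟩
  · rw [ballIn_omega (Ext.bexIn (.const _) fun _ => Ext.mem .id (.const _))]
    intro k q _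
    obtain ⟨s, -, hs, -⟩ := exists_splitNode_length q (nil_mem q) 0
    obtain ⟨n, hn, hkn⟩ := (q.2.infinite_succ s hs).exists_gt k
    exact ⟨restrict q (s ++ [n]) hn, restrict_le, check (PSet.ofNat n),
      mem_rangeName (memRange_restrict (by simp)), ofNat_mem_ofNat.2 hkn⟩

theorem cofinalOn_rangeName (hb : IsUnboundedSeq b) (hc : IsUnboundedSeq c) (p : MillerForcing) :
    cofinalOn (check (ω₁ : Ordinal.{0}).toPSet) rangeName (check (PSet.ofSeq b))
      (check (PSet.ofSeq c)) p := by
  have hext : ∀ x y : PName MillerForcing, Ext fun z : PName MillerForcing => ex fun f =>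
      ex fun g => mem (pair x f) (check (PSet.ofSeq c)) ⩕
        mem (pair z g) (check (PSet.ofSeq b)) ⩕ evDomOn y f g :=
    fun x y => .ex fun _ => .ex fun _ => .and (.mem (.const _) (.const _))
      (.and (.mem (.pair .id (.const _)) (.const _)) (.evDomOn (.const _) (.const _) (.const _)))
  have hext' : Ext fun x : PName MillerForcing => bexIn (check (ω₁ : Ordinal.{0}).toPSet)
      fun z => ex fun f => ex fun g => mem (pair x f) (check (PSet.ofSeq c)) ⩕
        mem (pair z g) (check (PSet.ofSeq b)) ⩕ evDomOn rangeName f g :=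
    .bexIn (.const _) fun _ => .ex fun _ => .ex fun _ => .and (.mem (.pair .id (.const _))
      (.const _)) (.and (.mem (.const _) (.const _)) (.evDomOn (.const _) (.const _) (.const _)))
  rw [cofinalOn, ballIn_toPSet hext']
  intro α
  refine hext'.dense fun q _ => ?_
  obtain ⟨β, S, hSq, K, hK⟩ := hb.exists_dominating q (hc.monotone α)
  refine ⟨S, hSq, bexIn_toPSet_intro (hext _ _) β ?_⟩
  refine ex_intro (check (PSet.ofReal (c α))) fun r hr =>
    ex_intro (check (PSet.ofReal (b β))) fun r' hr' =>
      ⟨pair_toPSet_mem_ofSeq.2 (eq_refl _ _), pair_toPSet_mem_ofSeq.2 (eq_refl _ _), ?_⟩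
  refine evDomOn_ofReal K fun u hu y hy u' hu' => ?_
  obtain ⟨v, hv, n, hn, e⟩ := exists_of_mem_rangeName (mem_mono hu' hy)
  -- Some extension has `n` as an entry of one of its nodes, which is also a node of `S`, so the
  -- bound beyond `K` applies.
  obtain ⟨w, hw, s, hs, hns⟩ := exists_mem_of_memRange hn
  have hwS : w ≤ S := hw.trans (hv.trans (hu'.trans (hu.trans (hr'.trans hr))))
  exact ⟨w, hw.trans hv, n, eq_mono hw e, hK s (hwS hs) n hns⟩

theorem lockedBy_rangeName (hb : IsUnboundedSeq b) (hc : IsUnboundedSeq c) (p : MillerForcing) :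
    lockedBy rangeName (check (PSet.ofSeq b)) (check (PSet.ofSeq c)) p :=
  ex_intro (check (ω₁ : Ordinal.{0}).toPSet) fun q _ =>
    ⟨isOmegaOne_omega_one q, isUnbounded_ofSeq hb q, isUnbounded_ofSeq hc q,
      isInfiniteSubset_rangeName q, cofinalOn_rangeName hb hc q, cofinalOn_rangeName hc hb q⟩

end MillerForcing

/-- Miller forcing forces that any two unbounded sequences from the ground model are locked,
namely by the range of the Miller real. -/
theorem theorem5p6 (b c : (ω₁ : Ordinal.{0}).ToType → ℕ → ℕ)
    (hb : IsUnboundedSeq b) (hc : IsUnboundedSeq c) :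
    FSent.Forced (PName.locked (P := MillerForcing)
      (PName.check (PSet.ofSeq b)) (PName.check (PSet.ofSeq c))) ∧
    FSent.Forced (PName.lockedBy MillerForcing.rangeName
      (PName.check (PSet.ofSeq b)) (PName.check (PSet.ofSeq c))) :=
  ⟨fun _ => PName.ex_intro MillerForcing.rangeName fun q _ =>
    MillerForcing.lockedBy_rangeName hb hc q, fun p => MillerForcing.lockedBy_rangeName hb hc p⟩
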